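/- For $a$ in $\mathbb{R}^n$ or $\mathbb{R}$ write $\langle a\rangle=(1+|a|^2)^{1/2}$. For $w$ on $\mathbb{R}^n\times\mathbb{R}$ let $\widehat w(\xi,\tau)=\int_{\mathbb{R}^n\times\mathbb{R}}e^{-i(x\cdot\xi+t\tau)}w(x,t)\,dx\,dt$, extended as usual to tempered distributions, and for $s,\theta\in\mathbb{R}$ let $$\|w\|_{X^{s,\theta}}=\big\|\langle\xi\rangle^s\langle\tau-|\xi|^2\rangle^\theta\,\widehat w(\xi,\tau)\big\|_{L^2_{\xi,\tau}(\mathbb{R}^n\times\mathbb{R})}.$$ $X^{s,\theta}$ is the space of tempered distributions $w$ on $\mathbb{R}^n\times\mathbb{R}$ whose Fourier transform is a function and for which $\|w\|_{X^{s,\theta}}<\infty$. Call $(n,s,\theta)$ admissible if one of the following holds: 1. $n=2$, $\frac12<\theta\ne\frac34$ and $\max\{\theta-\frac54,\,2\theta-2\}\le s<0$; 2. $n=2$, $\theta=\frac34$ and $-\frac12<s<0$; 3. $n=3$, $\theta>\frac12$ and $2\theta-\frac32\le s<0$. **Proposition.** If $(n,s,\theta)$ is admissible, then there is a constant $C$,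 depending only on $n,s,\theta$, such that $$\|\overline u\,\overline v\|_{X^{s,\theta-1}}\le C\,\|u\|_{X^{s,\theta}}\|v\|_{X^{s,\theta}}$$ for all Schwartz functions $u,v$ on $\mathbb{R}^n\times\mathbb{R}$, and also for all $u,v\in X^{s,\theta}$, where the product $\overline u\,\overline v\in X^{s,\theta-1}$ is the one determined by continuity: for all $u,v\in X^{s,\theta}$ there is a unique tempered distribution $w=:\overline u\,\overline v$ such that $\overline{u_k}\,\overline{v_k}\to w$ in $X^{s,\theta-1}$ whenever $u_k,v_k$ are Schwartz functions with $u_k\to u$ and $v_k\to v$ in $X^{s,\theta}$, and this $w$ satisfies the estimate. -/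

import Mathlib

open MeasureTheory Filter Topology
open scoped SchwartzMap ENNReal NNReal

noncomputable section

/-- Space-time `ℝⁿ × ℝ`; points are pairs `(x, t)`, and frequencies are pairs `(ξ, τ)`. -/
abbrev SpaceTime (n : ℕ) : Type := EuclideanSpace ℝ (Fin n) × ℝ

instance instIsAddHaarMeasureSpaceTime (n : ℕ) :
    (volume : Measure (SpaceTime n)).IsAddHaarMeasure :=
  Measure.prod.instIsAddHaarMeasure volume volume

/-- The bracket `⟨a⟩ = (1 + |a|²)^{1/2}`. -/
def bracket {V : Type*} [Norm V] (a : V) : ℝ := Real.sqrt (1 + ‖a‖ ^ 2)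

/-- The space-time Fourier transform
`ŵ(ξ, τ) = ∫ e^{-i(x·ξ + tτ)} w(x, t) dx dt` of a function. -/
def spacetimeFourier {n : ℕ} (w : SpaceTime n → ℂ) (ζ : SpaceTime n) : ℂ :=
  ∫ z : SpaceTime n,
    Complex.exp (-(Complex.I * ((inner ℝ z.1 ζ.1 + z.2 * ζ.2 : ℝ) : ℂ))) * w z

/-- `‖⟨ξ⟩^s ⟨τ - |ξ|²⟩^θ f(ξ, τ)‖` in `L²(ℝⁿ × ℝ)`, for a function `f` of the frequencies
(with value `∞` if this is infinite). -/
def weightedL2Norm {n : ℕ} (s θ : ℝ) (f : SpaceTime n → ℂ) : ℝ≥0∞ :=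
  eLpNorm (fun ζ : SpaceTime n =>
    ((bracket ζ.1 ^ s * bracket (ζ.2 - ‖ζ.1‖ ^ 2) ^ θ : ℝ) : ℂ) * f ζ) 2 volume

/-- The Bourgain norm `‖w‖_{X^{s,θ}} = ‖⟨ξ⟩^s ⟨τ - |ξ|²⟩^θ ŵ(ξ, τ)‖_{L²}` of an integrable
function `w`. -/
def bourgainNorm {n : ℕ} (s θ : ℝ) (w : SpaceTime n → ℂ) : ℝ≥0∞ :=
  weightedL2Norm s θ (spacetimeFourier w)

/-- The Fourier transform of the tempered distribution `T` is the function `f`: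
`∫ f φ = ⟨T, φ̂⟩` for every Schwartz function `φ` (`ψ` is the Schwartz function `φ̂`). -/
def HasFourierTransform {n : ℕ} (T : 𝓢'(SpaceTime n, ℂ)) (f : SpaceTime n → ℂ) : Prop :=
  (∀ φ : 𝓢(SpaceTime n, ℂ), Integrable (fun ζ => f ζ * φ ζ) volume) ∧
  ∀ φ ψ : 𝓢(SpaceTime n, ℂ), (∀ ζ, ψ ζ = spacetimeFourier φ ζ) →
    T ψ = ∫ ζ, f ζ * φ ζ

/-- The Bourgain norm of a tempered distribution. The function that represents its Fourier
transform is unique up to null sets; if there is none, the norm is `∞`.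
The space `X^{s,θ}` consists of the tempered distributions of finite norm. -/
def distBourgainNorm {n : ℕ} (s θ : ℝ) (T : 𝓢'(SpaceTime n, ℂ)) : ℝ≥0∞ :=
  ⨅ (f : SpaceTime n → ℂ) (_ : HasFourierTransform T f), weightedL2Norm s θ f

/-- The Schwartz function `ū v̄`. -/
def conjMul {n : ℕ} (u v : 𝓢(SpaceTime n, ℂ)) : 𝓢(SpaceTime n, ℂ) :=
  SchwartzMap.pairing (ContinuousLinearMap.mul ℝ ℂ)
    (SchwartzMap.postcompCLM (Complex.conjCLE : ℂ →L[ℝ] ℂ) u)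
    (SchwartzMap.postcompCLM (Complex.conjCLE : ℂ →L[ℝ] ℂ) v)

theorem conjMul_apply {n : ℕ} (u v : 𝓢(SpaceTime n, ℂ)) (z : SpaceTime n) :
    conjMul u v z = starRingEnd ℂ (u z) * starRingEnd ℂ (v z) := rfl

/-- A Schwartz function as a tempered distribution, `φ ↦ ∫ w φ`. -/
def toDist {n : ℕ} (w : 𝓢(SpaceTime n, ℂ)) : 𝓢'(SpaceTime n, ℂ) :=
  SchwartzMap.toTemperedDistributionCLM (SpaceTime n) ℂ volume w

theorem toDist_apply {n : ℕ} (w φ : 𝓢(SpaceTime n, ℂ)) :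
    toDist w φ = ∫ z, φ z * w z :=
  SchwartzMap.toTemperedDistributionCLM_apply_apply volume w φ

/-- `w` is the product `ū v̄` of elements `u`, `v` of `X^{s,θ}`, as an element of `X^{s,θ-1}`:
whenever Schwartz functions `uₖ → u` and `vₖ → v` in `X^{s,θ}`, the pointwise products
`ūₖ v̄ₖ` converge to `w` in `X^{s,θ-1}`. -/
def IsConjProduct {n : ℕ} (s θ : ℝ) (u v w : 𝓢'(SpaceTime n, ℂ)) : Prop :=
  ∀ u' v' : ℕ → 𝓢(SpaceTime n, ℂ),
    Tendsto (fun k => distBourgainNorm s θ (toDist (u' k) - u)) atTop (𝓝 0) →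
    Tendsto (fun k => distBourgainNorm s θ (toDist (v' k) - v)) atTop (𝓝 0) →
    Tendsto (fun k => distBourgainNorm s (θ - 1) (toDist (conjMul (u' k) (v' k)) - w))
      atTop (𝓝 0)

/-- Admissible triplets `(n, s, θ)`. -/
def Admissible (n : ℕ) (s θ : ℝ) : Prop :=
  (n = 2 ∧ 1 / 2 < θ ∧ θ ≠ 3 / 4 ∧ max (θ - 5 / 4) (2 * θ - 2) ≤ s ∧ s < 0) ∨
  (n = 2 ∧ θ = 3 / 4 ∧ -(1 / 2) < s ∧ s < 0) ∨
  (n = 3 ∧ 1 / 2 < θ ∧ 2 * θ - 3 / 2 ≤ s ∧ s < 0)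

end

/-!
The estimate is an estimate for functions of the frequencies. If `f = û` and `g = v̂`, then `ū v̄`
has the Fourier transform `conjConvolution f g`, a multiple of `∫ f̄(η) ḡ(-ζ-η) dη`; so, by duality
and with `k = -s ≥ 0`, a trilinear form over `x + y + z = 0` has to be bounded on `L² × L² × L²`,
with a weight built from the frequencies `ξ` and the modulations `τ - |ξ|²` of `x`, `y` and `z`.

Because both factors are conjugated there is no resonance: over `x + y + z = 0` the three
modulations add up to `-(|ξ_x|² + |ξ_y|² + |ξ_z|²)`, so one of them is at least a multiple of `N²`,
where `N` is the largest frequency. Its weight is traded for `N^{2θ-2}`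
(`bourgainWeight_mul_le`), and what remains, up to permuting the variables, is the weight
`N^{2k+2θ-2} L^{-k}`, where `L` is the smallest frequency, times the weights `⟨τ - |ξ|²⟩^{-θ}` of
two of the variables, `y` and `z`. Put `N^{2k+2θ-2} = N^α N^{1/2}` with `α = 2k + 2θ - 5/2 ≤ 0`.

The kernel with two modulation weights is estimated by Cauchy–Schwarz
(`lintegral_trilinear_le`). Its square is integrable since `2θ > 1`: for fixed `x`, integrating out
`τ_y` leaves the thickened sphere on which `|ξ_y|² + |ξ_z|²` is fixed up to `O(1)`. The sphere of
radius `r = |ξ_y - ξ_z| / 2` has thickness `1/r`, so with the factor `N^{1/2} ≲ (L + r)^{1/2}` its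
part in a cube of side `O(L)` has mass `O(L^{n-1})` (`setLIntegral_ebox_le`,
`lintegral_cubeInd_mul_scaleKernel_le`). The localization to such cubes is free: either `ξ_y` or
`ξ_z` is itself `O(L)`, or `ξ_x` is, and then `ξ_y` and `ξ_z` lie in opposite cubes of side `O(L)`,
and the pieces are almost orthogonal (`trilinear_scaleKernel_le_of_low_first`). It remains to sum
`L^{(n-1)/2-k} N^α` over the dyadic values `L ≤ N`, which is possible if `2α + n - 1 - 2k ≤ 0` and
one of `α` and `n - 1 - 2k` is negative (`exists_tsum_l2norm_shellGain_sq_le`). These conditions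
follow from admissibility, and lead to `exists_l2norm_bilinear_le`.

The statement for distributions follows by continuity. Multiplication by the weight and by its
inverse preserves Schwartz functions, so every measurable function with finite weighted norm is the
Fourier transform of a tempered distribution
(`exists_hasFourierTransform_of_weightedL2Norm_lt_top`), and Schwartz functions are dense in
`X^{s,θ}` (`exists_tendsto_distBourgainNorm`). Density gives the uniqueness of the product, and the
product is the distribution with Fourier transform `conjConvolution f g`
(`BilinearBound.isConjProduct`).
-/

/-! ### Integrals of decaying weights over cubes -/

/-- The decaying weight `⟨v⟩^{-p}` with values in `[0, ∞]`. -/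
noncomputable def bracketDecay (p v : ℝ) : ℝ≥0∞ := ENNReal.ofReal (bracket v ^ (-p))

theorem one_le_bracket {V : Type*} [SeminormedAddCommGroup V] (a : V) : 1 ≤ bracket a := by
  unfold bracket
  rw [Real.one_le_sqrt]
  nlinarith [sq_nonneg ‖a‖]

theorem bracket_pos {V : Type*} [SeminormedAddCommGroup V] (a : V) : 0 < bracket a :=
  lt_of_lt_of_le one_pos (one_le_bracket a)

@[fun_prop]
theorem continuous_bracket {V : Type*} [SeminormedAddCommGroup V] :
    Continuous (bracket : V → ℝ) := by
  unfold bracket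
  fun_prop

@[fun_prop]
theorem measurable_bracketDecay (p : ℝ) : Measurable (bracketDecay p) := by
  unfold bracketDecay
  have : Continuous (bracket : ℝ → ℝ) := continuous_bracket
  fun_prop

@[simp]
theorem bracket_neg {V : Type*} [SeminormedAddCommGroup V] (a : V) : bracket (-a) = bracket a := by
  simp [bracket]

/-- The total mass `∫ ⟨v⟩^{-p} dv` of the weight. -/
noncomputable def decayMass (p : ℝ) : ℝ≥0∞ := ∫⁻ v, bracketDecay p v

theorem decayMass_lt_top {p : ℝ} (hp : 1 < p) : decayMass p < ∞ := by
  have h : Integrable (fun x : ℝ => (1 + ‖x‖ ^ 2) ^ (-p / 2)) volume :=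
    integrable_rpow_neg_one_add_norm_sq (by simpa using hp)
  have h2 := h.lintegral_lt_top
  unfold decayMass bracketDecay
  convert h2 using 4 with v
  rw [bracket, Real.sqrt_eq_rpow, ← Real.rpow_mul (by positivity)]
  congr 1
  ring

/-- The substitution `v = B + 2 t²`: the factor `t` makes up for the slow variation of `t²` near
`t = 0`, so the bound does not depend on `B`. -/
theorem setLIntegral_mul_bracketDecay_le (p B : ℝ) :
    ∫⁻ t in Set.Ioi 0, ENNReal.ofReal t * bracketDecay p (B + 2 * t ^ 2) ≤ decayMass p := by
  have h := lintegral_image_eq_lintegral_abs_deriv_mul (s := Set.Ioi (0 : ℝ))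
    (f := fun t => B + 2 * t ^ 2) (f' := fun t => 4 * t) measurableSet_Ioi
    (fun x _ => by
      have := ((hasDerivAt_pow 2 x).const_mul 2).const_add B
      refine HasDerivAt.hasDerivWithinAt ?_
      convert this using 1
      ring)
    (fun x hx y hy hxy => by
      simp only [Set.mem_Ioi] at hx hy
      have h2 : x ^ 2 = y ^ 2 := by simpa using hxy
      exact (sq_eq_sq₀ hx.le hy.le).1 h2)
    (bracketDecay p)
  calc _ ≤ ∫⁻ t in Set.Ioi 0, ENNReal.ofReal |4 * t| * bracketDecay p (B + 2 * t ^ 2) := by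
        refine setLIntegral_mono' measurableSet_Ioi fun t ht => ?_
        gcongr
        rw [Set.mem_Ioi] at ht
        rw [abs_of_pos (by positivity)]
        linarith
    _ ≤ _ := by rw [← h]; exact setLIntegral_le_lintegral _ _

theorem lintegral_abs_mul_bracketDecay_le (p B : ℝ) :
    ∫⁻ t : ℝ, ENNReal.ofReal |t| * bracketDecay p (B + 2 * t ^ 2) ≤ 2 * decayMass p := by
  have hpos : ∫⁻ t in Set.Ioi 0, ENNReal.ofReal |t| * bracketDecay p (B + 2 * t ^ 2)
      ≤ decayMass p := by
    refine le_trans (le_of_eq ?_) (setLIntegral_mul_bracketDecay_le p B)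
    refine setLIntegral_congr_fun measurableSet_Ioi fun t ht => ?_
    rw [Set.mem_Ioi] at ht
    simp only [abs_of_pos ht]
  have hneg : ∫⁻ t in Set.Iic 0, ENNReal.ofReal |t| * bracketDecay p (B + 2 * t ^ 2)
      ≤ decayMass p := by
    refine le_trans (le_of_eq ?_) hpos
    rw [← lintegral_indicator measurableSet_Iic, ← lintegral_indicator measurableSet_Ioi,
      ← lintegral_neg_eq_self]
    refine lintegral_congr_ae ?_
    filter_upwards [compl_mem_ae_iff.2 (measure_singleton (0 : ℝ))] with t ht
    have ht : t ≠ 0 := by simpa using ht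
    by_cases h : 0 < t
    · simp [Set.indicator, h, h.le]
    · simp [Set.indicator, h, lt_of_le_of_ne (not_lt.1 h) ht]
  rw [← lintegral_add_compl _ (measurableSet_Ioi (a := (0 : ℝ))), Set.compl_Ioi, two_mul]
  exact add_le_add hpos hneg

theorem lintegral_plane_bracketDecay_le (p B : ℝ) :
    ∫⁻ q : ℝ × ℝ, bracketDecay p (B + 2 * (q.1 ^ 2 + q.2 ^ 2)) ≤
      ENNReal.ofReal (2 * Real.pi) * decayMass p := by
  rw [← lintegral_comp_polarCoord_symm]
  have : ∀ q : ℝ × ℝ, (polarCoord.symm q).1 ^ 2 + (polarCoord.symm q).2 ^ 2 = q.1 ^ 2 := by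
    intro q
    simp only [polarCoord_symm_apply]
    nlinarith [Real.sin_sq_add_cos_sq q.2]
  simp only [this, polarCoord_target, smul_eq_mul]
  rw [Measure.volume_eq_prod, ← Measure.prod_restrict, lintegral_prod _ (by fun_prop)]
  simp only [lintegral_const, Measure.restrict_apply MeasurableSet.univ, Set.univ_inter,
    Real.volume_Ioo]
  rw [lintegral_mul_const _ (by fun_prop), mul_comm]
  have : Real.pi - -Real.pi = 2 * Real.pi := by ring
  rw [this]
  gcongr
  exact setLIntegral_mul_bracketDecay_le p B

/-- The cube with center `c` and side length `2 R`. -/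
def box {ι : Type*} (c : ι → ℝ) (R : ℝ) : Set (ι → ℝ) := {η | ∀ i, |η i - c i| ≤ R}

theorem box_eq_Icc {ι : Type*} (c : ι → ℝ) (R : ℝ) :
    box c R = Set.Icc (fun i => c i - R) (fun i => c i + R) := by
  ext η
  simp only [box, Set.mem_ofPred_eq, Set.mem_Icc, Pi.le_def, abs_le, ← forall_and]
  refine forall_congr' fun i => ?_
  constructor <;> rintro ⟨h1, h2⟩ <;> constructor <;> linarith

theorem measurableSet_box {m : ℕ} (c : Fin m → ℝ) (R : ℝ) : MeasurableSet (box c R) := by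
  rw [box_eq_Icc]; exact measurableSet_Icc

theorem volume_box {m : ℕ} (c : Fin m → ℝ) (R : ℝ) :
    volume (box c R) = ENNReal.ofReal (2 * R) ^ m := by
  rw [box_eq_Icc, Real.volume_Icc_pi]
  have : ∀ i, c i + R - (c i - R) = 2 * R := fun i => by ring
  simp [this]

/-- One coordinate at a time: integrating out the `i`-th coordinate of a cube. -/
theorem setLIntegral_box_succ_le {m : ℕ} (i : Fin (m + 1)) (c : Fin (m + 1) → ℝ) (R : ℝ)
    {F : ℝ × (Fin m → ℝ) → ℝ≥0∞} (hF : Measurable F) :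
    ∫⁻ η in box c R, F (η i, fun j => η (i.succAbove j)) ≤
      ∫⁻ η' in box (fun j => c (i.succAbove j)) R,
        ∫⁻ t in {t | |t - c i| ≤ R}, F (t, η') := by
  have hset : MeasurableSet {t : ℝ | |t - c i| ≤ R} :=
    measurableSet_le (by fun_prop) measurable_const
  have hbox := measurableSet_box (fun j => c (i.succAbove j)) R
  have hvp := volume_preserving_piFinSuccAbove (fun _ : Fin (m + 1) => ℝ) i
  have hpre : box c R = (MeasurableEquiv.piFinSuccAbove (fun _ : Fin (m + 1) => ℝ) i) ⁻¹'
      ({t | |t - c i| ≤ R} ×ˢ box (fun j => c (i.succAbove j)) R) := by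
    ext η
    simp only [box, Set.mem_ofPred_eq, Set.mem_preimage, Set.mem_prod,
      MeasurableEquiv.piFinSuccAbove_apply, Fin.insertNthEquiv_symm_apply, Fin.removeNth]
    exact Fin.forall_iff_succAbove i
  have hint : ∫⁻ η in box c R, F (η i, fun j => η (i.succAbove j)) =
      ∫⁻ q in ({t | |t - c i| ≤ R} ×ˢ box (fun j => c (i.succAbove j)) R), F q := by
    rw [hpre, ← hvp.setLIntegral_comp_preimage (hset.prod hbox) hF]
    rfl
  rw [hint, Measure.volume_eq_prod, ← Measure.prod_restrict, lintegral_prod_symm _ hF.aemeasurable]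

/-- With the factor `|η i|`, the integral in the `i`-th coordinate is bounded by the total mass of
the weight, and the other coordinates contribute the volume of a face of the cube. -/
theorem setLIntegral_box_abs_le {m : ℕ} (i : Fin (m + 1)) (c : Fin (m + 1) → ℝ) (R p B : ℝ) :
    ∫⁻ η in box c R, ENNReal.ofReal |η i| * bracketDecay p (B + 2 * ∑ j, η j ^ 2) ≤
      2 * decayMass p * ENNReal.ofReal (2 * R) ^ m := by
  have := setLIntegral_box_succ_le i c R (F := fun q : ℝ × (Fin m → ℝ) =>
    ENNReal.ofReal |q.1| * bracketDecay p (B + 2 * (q.1 ^ 2 + ∑ j, q.2 j ^ 2))) (by fun_prop)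
  simp only [Fin.sum_univ_succAbove _ i]
  refine this.trans ?_
  rw [← volume_box (fun j => c (i.succAbove j)) R, ← setLIntegral_const]
  refine lintegral_mono fun η' => ?_
  refine (setLIntegral_le_lintegral _ _).trans ?_
  refine le_trans (le_of_eq ?_) (lintegral_abs_mul_bracketDecay_le p (B + 2 * ∑ j, η' j ^ 2))
  congr 1 with t
  congr 2
  ring

/-- Without a factor `|η i|` two coordinates are used: in polar coordinates of their plane the area
element supplies the factor `r`. -/
theorem setLIntegral_box_bracketDecay_le (m : ℕ) (c : Fin (m + 2) → ℝ) (R p B : ℝ) :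
    ∫⁻ η in box c R, bracketDecay p (B + 2 * ∑ j, η j ^ 2) ≤
      ENNReal.ofReal (2 * Real.pi) * decayMass p * ENNReal.ofReal (2 * R) ^ m := by
  induction m generalizing B with
  | zero =>
    simp only [pow_zero, mul_one]
    refine (setLIntegral_le_lintegral _ _).trans ?_
    refine le_trans (le_of_eq ?_) (lintegral_plane_bracketDecay_le p B)
    rw [← (volume_preserving_finTwoArrow ℝ).lintegral_comp (by fun_prop)]
    simp [Fin.sum_univ_two, MeasurableEquiv.finTwoArrow]
  | succ m ih =>
    have := setLIntegral_box_succ_le 0 c R (F := fun q : ℝ × (Fin (m + 2) → ℝ) =>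
      bracketDecay p (B + 2 * (q.1 ^ 2 + ∑ j, q.2 j ^ 2))) (by fun_prop)
    simp only [Fin.sum_univ_succAbove _ (0 : Fin (m + 3))]
    refine this.trans ?_
    rw [lintegral_lintegral_swap (by fun_prop)]
    calc _ ≤ ∫⁻ t in {t : ℝ | |t - c 0| ≤ R},
          ENNReal.ofReal (2 * Real.pi) * decayMass p * ENNReal.ofReal (2 * R) ^ m := by
          refine lintegral_mono fun t => ?_
          refine le_trans (le_of_eq ?_) (ih (fun j => c (Fin.succAbove 0 j)) (B + 2 * t ^ 2))
          congr 1 with η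
          congr 1
          ring
      _ = _ := by
          have hI : {t : ℝ | |t - c 0| ≤ R} = Set.Icc (c 0 - R) (c 0 + R) := by
            ext t
            simp only [Set.mem_ofPred_eq, Set.mem_Icc, abs_le]
            constructor <;> rintro ⟨h1, h2⟩ <;> constructor <;> linarith
          have h2 : c 0 + R - (c 0 - R) = 2 * R := by ring
          rw [setLIntegral_const, hI, Real.volume_Icc, h2, pow_succ]
          ring

/-- The points of Euclidean space whose coordinates lie in a cube. -/
def ebox {n : ℕ} (c : Fin n → ℝ) (R : ℝ) : Set (EuclideanSpace ℝ (Fin n)) :=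
  {ξ | ∀ i, |ξ i - c i| ≤ R}

theorem ebox_eq_preimage {n : ℕ} (c : Fin n → ℝ) (R : ℝ) :
    (ebox c R : Set (EuclideanSpace ℝ (Fin n))) = WithLp.ofLp ⁻¹' box c R := rfl

theorem measurableSet_ebox {n : ℕ} (c : Fin n → ℝ) (R : ℝ) :
    MeasurableSet (ebox c R : Set (EuclideanSpace ℝ (Fin n))) := by
  rw [ebox_eq_preimage]
  exact (PiLp.volume_preserving_ofLp (Fin n)).measurable (measurableSet_box c R)

theorem norm_le_sum_abs {n : ℕ} (ξ : EuclideanSpace ℝ (Fin n)) : ‖ξ‖ ≤ ∑ i, |ξ i| := by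
  rw [EuclideanSpace.norm_eq]
  refine Real.sqrt_le_iff.2 ⟨Finset.sum_nonneg fun i _ => abs_nonneg _, ?_⟩
  simp only [Real.norm_eq_abs]
  exact Finset.sum_sq_le_sq_sum_of_nonneg fun i _ => abs_nonneg _

/-- The measure of the part of a thickened sphere `{|B + 2|ξ|²| ≲ 1}` that lies in a cube of side
`4 L`, weighted by the reciprocal `L + |ξ|` of its thickness, is `O(L^{n-1})`. -/
theorem setLIntegral_ebox_le (m : ℕ) {p : ℝ} (hp : 1 < p) :
    ∃ C : ℝ≥0, ∀ (c : Fin (m + 2) → ℝ) (L : ℝ) (_ : 1 ≤ L) (B : ℝ),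
      ∫⁻ ξ in (ebox c (2 * L) : Set (EuclideanSpace ℝ (Fin (m + 2)))),
        ENNReal.ofReal (2 * L + 2 * ‖ξ‖) * bracketDecay p (B + 2 * ‖ξ‖ ^ 2) ≤
      C * ENNReal.ofReal L ^ (m + 1) := by
  set A : ℝ≥0∞ := 2 * (ENNReal.ofReal (2 * Real.pi) * decayMass p * 4 ^ m) +
    2 * ((m + 2) * (2 * decayMass p * 4 ^ (m + 1))) with hA
  have hJ := (decayMass_lt_top hp).ne
  have hAt : A ≠ ∞ := by finiteness
  refine ⟨A.toNNReal, fun c L hL B => ?_⟩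
  rw [ENNReal.coe_toNNReal hAt]
  have hvp := PiLp.volume_preserving_ofLp (Fin (m + 2))
  have hL2 : ENNReal.ofReal (2 * (2 * L)) = 4 * ENNReal.ofReal L := by
    rw [← mul_assoc, ENNReal.ofReal_mul (by norm_num)]
    norm_num
  have key : ∀ ξ : EuclideanSpace ℝ (Fin (m + 2)),
      ENNReal.ofReal (2 * L + 2 * ‖ξ‖) * bracketDecay p (B + 2 * ‖ξ‖ ^ 2) ≤
      2 * ENNReal.ofReal L * bracketDecay p (B + 2 * ∑ j, ξ.ofLp j ^ 2) +
      ∑ i, 2 * (ENNReal.ofReal |ξ.ofLp i| * bracketDecay p (B + 2 * ∑ j, ξ.ofLp j ^ 2)) := by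
    intro ξ
    rw [EuclideanSpace.real_norm_sq_eq]
    have : ENNReal.ofReal (2 * L + 2 * ‖ξ‖) ≤
        2 * ENNReal.ofReal L + ∑ i, 2 * ENNReal.ofReal |ξ.ofLp i| := by
      rw [← Finset.mul_sum, ← ENNReal.ofReal_sum_of_nonneg (fun i _ => abs_nonneg _),
        ← mul_add (2 : ℝ), ENNReal.ofReal_mul (by norm_num), ← mul_add, ← ENNReal.ofReal_add
        (by linarith) (Finset.sum_nonneg fun i _ => abs_nonneg _), ENNReal.ofReal_ofNat]
      gcongr
      exact norm_le_sum_abs ξ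
    refine (mul_le_mul_left this _).trans (le_of_eq ?_)
    rw [add_mul, Finset.sum_mul]
    simp only [mul_assoc]
  refine (lintegral_mono key).trans ?_
  rw [ebox_eq_preimage, hvp.setLIntegral_comp_preimage (measurableSet_box c (2 * L))
    (f := fun η : Fin (m + 2) → ℝ => 2 * ENNReal.ofReal L * bracketDecay p (B + 2 * ∑ j, η j ^ 2) +
      ∑ i, 2 * (ENNReal.ofReal |η i| * bracketDecay p (B + 2 * ∑ j, η j ^ 2))) (by fun_prop),
    lintegral_add_left (by fun_prop), lintegral_const_mul _ (by fun_prop),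
    lintegral_finsetSum _ (fun i _ => by fun_prop), hA, add_mul]
  gcongr ?_ + ?_
  · refine (mul_le_mul_right (setLIntegral_box_bracketDecay_le m c (2 * L) p B) _).trans
      (le_of_eq ?_)
    rw [hL2, mul_pow, pow_succ]
    ring
  · calc _ ≤ ∑ i : Fin (m + 2), 2 * (2 * decayMass p * ENNReal.ofReal (2 * (2 * L)) ^ (m + 1)) := by
          refine Finset.sum_le_sum fun i _ => ?_
          rw [lintegral_const_mul _ (by fun_prop)]
          gcongr
          exact setLIntegral_box_abs_le i c (2 * L) p B
      _ = _ := by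
          rw [hL2, mul_pow]
          simp only [Finset.sum_const, Finset.card_univ, Fintype.card_fin, nsmul_eq_mul]
          push_cast
          ring

/-! ### Square norms and the kernel with two modulation weights -/

/-- The `L²` norm of a function with values in `[0, ∞]`. -/
noncomputable def l2norm {α : Type*} [MeasurableSpace α] (μ : Measure α) (F : α → ℝ≥0∞) : ℝ≥0∞ :=
  (∫⁻ a, F a ^ 2 ∂μ) ^ (1 / 2 : ℝ)

section L2

variable {α : Type*} [MeasurableSpace α] {μ : Measure α}

theorem ENNReal.rpow_half_sq (a : ℝ≥0∞) : (a ^ (1 / 2 : ℝ)) ^ 2 = a := by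
  rw [← ENNReal.rpow_two, ← ENNReal.rpow_mul]; norm_num

theorem l2norm_sq (F : α → ℝ≥0∞) : l2norm μ F ^ 2 = ∫⁻ a, F a ^ 2 ∂μ :=
  ENNReal.rpow_half_sq _

theorem l2norm_le_iff {F : α → ℝ≥0∞} {A : ℝ≥0∞} : l2norm μ F ≤ A ↔ ∫⁻ a, F a ^ 2 ∂μ ≤ A ^ 2 := by
  rw [← l2norm_sq, ENNReal.pow_le_pow_left_iff two_ne_zero]

theorem l2norm_mono {F G : α → ℝ≥0∞} (h : ∀ a, F a ≤ G a) : l2norm μ F ≤ l2norm μ G := by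
  unfold l2norm
  gcongr with a
  exact h a

theorem lintegral_mul_le_l2norm {F G : α → ℝ≥0∞} (hF : AEMeasurable F μ) (hG : AEMeasurable G μ) :
    ∫⁻ a, F a * G a ∂μ ≤ l2norm μ F * l2norm μ G := by
  have := ENNReal.lintegral_mul_le_Lp_mul_Lq μ Real.HolderConjugate.two_two hF hG
  simpa [l2norm] using this

/-- Cauchy–Schwarz for series. -/
theorem tsum_mul_le_of_tsum_sq_le {a b : ℕ → ℝ≥0∞} {A B : ℝ≥0∞} (ha : ∑' l, a l ^ 2 ≤ A ^ 2)
    (hb : ∑' l, b l ^ 2 ≤ B ^ 2) : ∑' l, a l * b l ≤ A * B := by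
  rw [← lintegral_count] at ha hb ⊢
  refine (lintegral_mul_le_l2norm (measurable_of_countable _).aemeasurable
    (measurable_of_countable _).aemeasurable).trans ?_
  exact mul_le_mul' (l2norm_le_iff.2 ha) (l2norm_le_iff.2 hb)

/-- Duality: the `L²` norm is determined by pairings with arbitrary measurable functions. -/
theorem l2norm_le_of_forall_lintegral_mul_le [SigmaFinite μ] {G : α → ℝ≥0∞} (hG : Measurable G)
    {A : ℝ≥0∞} (h : ∀ H : α → ℝ≥0∞, Measurable H → ∫⁻ a, H a * G a ∂μ ≤ A * l2norm μ H) :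
    l2norm μ G ≤ A := by
  let S := spanningSets μ
  let T : ℕ → α → ℝ≥0∞ := fun k => (S k).indicator fun a => min (G a) k
  have hTm : ∀ k, Measurable (T k) := fun k =>
    (hG.min measurable_const).indicator (measurableSet_spanningSets μ k)
  have hTG : ∀ k a, T k a ≤ G a := fun k a =>
    (Set.indicator_le_self' (fun _ _ => zero_le) a).trans (min_le_left _ _)
  have hmono : Monotone T := by
    intro i j hij a
    refine (Set.indicator_le_indicator_of_subset (monotone_spanningSets μ hij)
      (fun _ => zero_le) a).trans (Set.indicator_le_indicator ?_)
    exact min_le_min_left _ (by exact_mod_cast hij)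
  have hlim : ∀ a, Tendsto (fun k => T k a) atTop (𝓝 (G a)) := by
    intro a
    have h1 : Tendsto (fun k : ℕ => min (G a) (k : ℝ≥0∞)) atTop (𝓝 (min (G a) ∞)) :=
      tendsto_const_nhds.min ENNReal.tendsto_nat_nhds_top
    rw [min_eq_left le_top] at h1
    refine h1.congr' ?_
    obtain ⟨k, hk⟩ : ∃ k, a ∈ S k := by
      rw [← Set.mem_iUnion, iUnion_spanningSets μ]
      exact Set.mem_univ a
    filter_upwards [eventually_ge_atTop k] with j hj
    exact (Set.indicator_of_mem (monotone_spanningSets μ hj hk)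
      fun a => min (G a) (j : ℝ≥0∞)).symm
  have hfin : ∀ k, l2norm μ (T k) ≠ ∞ := by
    intro k
    refine ENNReal.rpow_ne_top_of_nonneg (by norm_num) (ne_top_of_le_ne_top (b :=
      ∫⁻ a, (S k).indicator (fun _ => (k : ℝ≥0∞) ^ 2) a ∂μ) ?_ (lintegral_mono fun a => ?_))
    · rw [lintegral_indicator (measurableSet_spanningSets μ k), setLIntegral_const]
      have := measure_spanningSets_lt_top μ k
      finiteness
    · by_cases ha : a ∈ S k
      · simp only [T, Set.indicator_of_mem ha]
        gcongr
        exact min_le_right _ _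
      · simp [T, Set.indicator_of_notMem ha]
  have hbd : ∀ k, ∫⁻ a, T k a ^ 2 ∂μ ≤ A ^ 2 := by
    intro k
    rw [← l2norm_le_iff]
    by_cases h0 : l2norm μ (T k) = 0
    · simp [h0]
    · have h1 : l2norm μ (T k) * l2norm μ (T k) ≤ A * l2norm μ (T k) := by
        rw [← pow_two, l2norm_sq]
        refine (lintegral_mono fun a => ?_).trans (h (T k) (hTm k))
        rw [pow_two]
        gcongr
        exact hTG k a
      exact (ENNReal.mul_le_mul_iff_left h0 (hfin k)).1 h1
  rw [l2norm_le_iff]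
  refine le_of_tendsto' (lintegral_tendsto_of_tendsto_of_monotone (f := fun k a => T k a ^ 2)
    (fun k => ((hTm k).pow_const 2).aemeasurable) (ae_of_all _ fun a i j hij => ?_)
    (ae_of_all _ fun a => ?_)) hbd
  · exact pow_le_pow_left' (hmono hij a) 2
  · exact ENNReal.Tendsto.pow (hlim a)

end L2

section Trilinear

variable {n : ℕ}

/-- Trilinear Cauchy–Schwarz: if the kernel is square integrable in `y`, uniformly in `x`, then
the trilinear form over `x + y + z = 0` is bounded on `L² × L² × L²`. -/
theorem lintegral_trilinear_le {f g h : SpaceTime n → ℝ≥0∞} (hf : Measurable f) (hg : Measurable g)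
    (hh : Measurable h) {κ : SpaceTime n → SpaceTime n → ℝ≥0∞} (hκ : Measurable κ.uncurry)
    {A : ℝ≥0∞} (hA : ∀ x, ∫⁻ y, κ x y ^ 2 ≤ A ^ 2) :
    ∫⁻ x, ∫⁻ y, f x * g y * h (-x - y) * κ x y ≤
      A * l2norm volume f * l2norm volume g * l2norm volume h := by
  have hκx : ∀ x, Measurable (κ x) := fun x => hκ.comp measurable_prodMk_left
  have hmeas : Measurable fun x : SpaceTime n => l2norm volume fun y => g y * h (-x - y) := by
    unfold l2norm
    refine Measurable.pow_const (Measurable.lintegral_prod_right ?_) _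
    fun_prop
  have hl2 : l2norm volume (fun x : SpaceTime n => l2norm volume fun y => g y * h (-x - y)) ≤
      l2norm volume g * l2norm volume h := by
    rw [l2norm_le_iff, mul_pow]
    simp only [l2norm_sq, mul_pow]
    rw [lintegral_lintegral_swap (by fun_prop), ← lintegral_mul_const _ (by fun_prop)]
    refine lintegral_mono fun y => ?_
    rw [lintegral_const_mul _ (by fun_prop)]
    refine mul_le_mul_right ?_ _
    have : ∀ x : SpaceTime n, h (-x - y) ^ 2 = (fun w => h w ^ 2) (-y - x) := fun x => by
      rw [show -x - y = -y - x by abel]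
    rw [lintegral_congr this]
    exact (lintegral_sub_left_eq_self (fun w => h w ^ 2) (-y)).le
  calc _ ≤ ∫⁻ x, A * (f x * l2norm volume fun y => g y * h (-x - y)) := by
        refine lintegral_mono fun x => ?_
        calc _ = f x * ∫⁻ y, (g y * h (-x - y)) * κ x y := by
              rw [← lintegral_const_mul _ (by fun_prop)]
              simp only [mul_assoc]
          _ ≤ f x * (l2norm volume (fun y => g y * h (-x - y)) * l2norm volume (κ x)) := by
              gcongr
              exact lintegral_mul_le_l2norm (by fun_prop) (by fun_prop)
          _ ≤ f x * (l2norm volume (fun y => g y * h (-x - y)) * A) := by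
              gcongr
              exact l2norm_le_iff.2 (hA x)
          _ = _ := by ring
    _ = A * ∫⁻ x, (f x * l2norm volume fun y => g y * h (-x - y)) :=
        lintegral_const_mul _ (by fun_prop)
    _ ≤ A * (l2norm volume f * (l2norm volume g * l2norm volume h)) := by
        gcongr
        exact (lintegral_mul_le_l2norm hf.aemeasurable hmeas.aemeasurable).trans (by gcongr)
    _ = _ := by ring

/-- The modulation weight `⟨τ - |ξ|²⟩^{-θ}`. -/
noncomputable def modDecay (θ : ℝ) (y : SpaceTime n) : ℝ≥0∞ := bracketDecay θ (y.2 - ‖y.1‖ ^ 2)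

@[fun_prop]
theorem measurable_modDecay (θ : ℝ) : Measurable (modDecay θ : SpaceTime n → ℝ≥0∞) := by
  unfold modDecay
  fun_prop

theorem bracketDecay_sq (p v : ℝ) : bracketDecay p v ^ 2 = bracketDecay (2 * p) v := by
  unfold bracketDecay
  rw [← ENNReal.ofReal_pow (Real.rpow_nonneg (bracket_pos v).le _), ← Real.rpow_natCast,
    ← Real.rpow_mul (bracket_pos v).le]
  congr 2
  push_cast
  ring

theorem bracketDecay_neg (p v : ℝ) : bracketDecay p (-v) = bracketDecay p v := by
  simp [bracketDecay]

/-- The kernel with two modulation weights at frequency scale `L`. The factor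
`(2 L + |ξ_y - ξ_z|)^{1/2}` compensates for the thickness of the level sets of
`|ξ_y|² + |ξ_z|²`. -/
noncomputable def scaleKernel (θ L : ℝ) (y z : SpaceTime n) : ℝ≥0∞ :=
  ENNReal.ofReal (2 * L + ‖y.1 - z.1‖) ^ (1 / 2 : ℝ) * modDecay θ y * modDecay θ z

@[fun_prop]
theorem measurable_scaleKernel (θ L : ℝ) :
    Measurable (fun q : SpaceTime n × SpaceTime n => scaleKernel θ L q.1 q.2) := by
  unfold scaleKernel
  fun_prop

/-- The indicator of the set of all `y = (ξ, τ)` with `ξ` in the cube of center `c` and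
side length `2 R`. -/
noncomputable def cubeInd (R : ℝ) (c : Fin n → ℝ) (y : SpaceTime n) : ℝ≥0∞ :=
  Set.indicator {q : (Fin n → ℝ) × SpaceTime n | ∀ i, |q.2.1 i - q.1 i| ≤ R} 1 (c, y)

@[fun_prop]
theorem measurable_cubeInd (R : ℝ) :
    Measurable (fun q : (Fin n → ℝ) × SpaceTime n => cubeInd R q.1 q.2) := by
  unfold cubeInd
  refine Measurable.indicator measurable_one ?_
  rw [show {q : (Fin n → ℝ) × SpaceTime n | ∀ i, |q.2.1 i - q.1 i| ≤ R} =
    ⋂ i, {q | |q.2.1 i - q.1 i| ≤ R} by ext; simp]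
  exact MeasurableSet.iInter fun i => measurableSet_le (by fun_prop) measurable_const

theorem cubeInd_sq (R : ℝ) (c : Fin n → ℝ) (y : SpaceTime n) :
    cubeInd R c y ^ 2 = cubeInd R c y := by
  unfold cubeInd Set.indicator
  split_ifs <;> simp

theorem lintegral_cubeInd (R : ℝ) (y : SpaceTime n) :
    ∫⁻ c, cubeInd R c y = ENNReal.ofReal (2 * R) ^ n := by
  rw [← volume_box y.1.ofLp R, ← lintegral_indicator_one (measurableSet_box _ _)]
  congr 1 with c
  simp only [cubeInd, Set.indicator, box, Set.mem_ofPred_eq, abs_sub_comm, Pi.one_apply]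
  congr

/-- The kernel estimate: at fixed `x`, the kernel at scale `L` localized in a cube of side `4 L`
has mass `O(L^{n-1})`. -/
theorem lintegral_cubeInd_mul_scaleKernel_le (m : ℕ) {θ : ℝ} (hθ : 1 / 2 < θ) :
    ∃ C : ℝ≥0, ∀ (c : Fin (m + 2) → ℝ) (L : ℝ) (_ : 1 ≤ L) (x : SpaceTime (m + 2)),
      ∫⁻ y, (cubeInd (2 * L) c y * scaleKernel θ L y (-x - y)) ^ 2 ≤
        C * ENNReal.ofReal L ^ (m + 1) := by
  have hp : 1 < 2 * θ := by linarith
  obtain ⟨C, hC⟩ := setLIntegral_ebox_le m hp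
  have hJ := (decayMass_lt_top hp).ne
  have hCt : C * decayMass (2 * θ) ≠ ∞ := by finiteness
  refine ⟨(C * decayMass (2 * θ)).toNNReal, fun c L hL x => ?_⟩
  rw [ENNReal.coe_toNNReal hCt]
  set D : EuclideanSpace ℝ (Fin (m + 2)) → ℝ≥0∞ := (ebox c (2 * L)).indicator 1 with hD
  have hDm : Measurable D := measurable_one.indicator (measurableSet_ebox c (2 * L))
  have hpt : ∀ y : SpaceTime (m + 2),
      (cubeInd (2 * L) c y * scaleKernel θ L y (-x - y)) ^ 2 =
      D y.1 * ENNReal.ofReal (2 * L + ‖y.1 - (-x.1 - y.1)‖) *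
        (bracketDecay (2 * θ) (y.2 - ‖y.1‖ ^ 2) *
          bracketDecay (2 * θ) (-x.2 - y.2 - ‖-x.1 - y.1‖ ^ 2)) := by
    intro y
    unfold scaleKernel modDecay
    rw [mul_pow, cubeInd_sq, mul_pow, mul_pow, ENNReal.rpow_half_sq, bracketDecay_sq,
      bracketDecay_sq]
    have : cubeInd (2 * L) c y = D y.1 := rfl
    rw [this]
    simp only [Prod.fst_sub, Prod.fst_neg, Prod.snd_sub, Prod.snd_neg]
    ring
  simp only [hpt]
  rw [Measure.volume_eq_prod, lintegral_prod _ (by fun_prop)]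
  have hτ : ∀ ξ : EuclideanSpace ℝ (Fin (m + 2)),
      ∫⁻ τ, D ξ * ENNReal.ofReal (2 * L + ‖ξ - (-x.1 - ξ)‖) *
        (bracketDecay (2 * θ) (τ - ‖ξ‖ ^ 2) *
          bracketDecay (2 * θ) (-x.2 - τ - ‖-x.1 - ξ‖ ^ 2)) =
      ∫⁻ τ, bracketDecay (2 * θ) τ * (D ξ * ENNReal.ofReal (2 * L + ‖ξ - (-x.1 - ξ)‖) *
          bracketDecay (2 * θ) ((τ + x.2 + ‖x.1‖ ^ 2 / 2) +
            2 * ‖ξ + (1 / 2 : ℝ) • x.1‖ ^ 2)) := by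
    intro ξ
    rw [← lintegral_add_right_eq_self _ (‖ξ‖ ^ 2)]
    refine lintegral_congr fun τ => ?_
    have h1 : -x.2 - (τ + ‖ξ‖ ^ 2) - ‖-x.1 - ξ‖ ^ 2 =
        -((τ + x.2 + ‖x.1‖ ^ 2 / 2) + 2 * ‖ξ + (1 / 2 : ℝ) • x.1‖ ^ 2) := by
      rw [← neg_add' x.1 ξ, norm_neg, norm_add_sq_real, norm_add_sq_real, inner_smul_right,
        norm_smul,
        real_inner_comm]
      norm_num
      ring
    rw [h1, bracketDecay_neg, add_sub_cancel_right]
    ring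
  simp only [hτ]
  rw [lintegral_lintegral_swap (by fun_prop)]
  calc _ ≤ ∫⁻ τ, bracketDecay (2 * θ) τ * (C * ENNReal.ofReal L ^ (m + 1)) := by
        refine lintegral_mono fun τ => ?_
        rw [lintegral_const_mul _ (by fun_prop)]
        gcongr
        refine le_trans (le_of_eq ?_) (hC (fun i => c i + (1 / 2) * x.1 i) L hL
          (τ + x.2 + ‖x.1‖ ^ 2 / 2))
        rw [← lintegral_indicator (measurableSet_ebox _ _)]
        refine Eq.trans ?_ (lintegral_add_right_eq_self _ ((1 / 2 : ℝ) • x.1))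
        refine lintegral_congr fun ξ => ?_
        have h2 : ξ - (-x.1 - ξ) = (2 : ℝ) • (ξ + (1 / 2 : ℝ) • x.1) := by module
        have h3 : ξ + (1 / 2 : ℝ) • x.1 ∈ ebox (fun i => c i + (1 / 2) * x.1 i) (2 * L) ↔
            ξ ∈ ebox c (2 * L) := by
          simp only [ebox, Set.mem_ofPred_eq, PiLp.add_apply, PiLp.smul_apply, smul_eq_mul,
            add_sub_add_right_eq_sub]
        rw [h2, norm_smul]
        by_cases hξ : ξ ∈ ebox c (2 * L)
        · rw [Set.indicator_of_mem (h3.2 hξ)]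
          simp [hD, hξ]
        · rw [Set.indicator_of_notMem (mt h3.1 hξ)]
          simp [hD, hξ]
    _ = _ := by
        rw [lintegral_mul_const _ (by fun_prop), ← decayMass]
        ring

end Trilinear

/-! ### Localization to cubes -/

section Localized

/-- The square root of `L^{m+1}`, the size of the kernel at scale `L` in dimension `m + 2`. -/
noncomputable def scaleGrowth (m : ℕ) (L : ℝ) : ℝ≥0∞ := (ENNReal.ofReal L ^ (m + 1)) ^ (1 / 2 : ℝ)

theorem cubeInd_eq_one {n : ℕ} {R : ℝ} {c : Fin n → ℝ} {y : SpaceTime n}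
    (h : ∀ i, |y.1 i - c i| ≤ R) : cubeInd R c y = 1 := by
  simp [cubeInd, Set.indicator, h]

theorem cubeInd_zero_eq_one_of_norm_le {n : ℕ} {R : ℝ} {y : SpaceTime n} (h : ‖y.1‖ ≤ R) :
    cubeInd R 0 y = 1 :=
  cubeInd_eq_one fun i => by simpa using (PiLp.norm_apply_le y.1 i).trans h

theorem norm_le_bracket {V : Type*} [SeminormedAddCommGroup V] (a : V) : ‖a‖ ≤ bracket a := by
  unfold bracket
  exact Real.le_sqrt_of_sq_le (by linarith)

/-- The trilinear form with the kernel at scale `L`, when the frequency of `g` is `O(L)`. -/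
theorem trilinear_scaleKernel_le_of_low_second (m : ℕ) {θ : ℝ} (hθ : 1 / 2 < θ) :
    ∃ C : ℝ≥0, ∀ (L : ℝ) (_ : 1 ≤ L) (f g h : SpaceTime (m + 2) → ℝ≥0∞) (_ : Measurable f)
      (_ : Measurable g) (_ : Measurable h) (_ : ∀ y, g y ≠ 0 → bracket y.1 ≤ 2 * L),
      ∫⁻ x, ∫⁻ y, f x * g y * h (-x - y) * scaleKernel θ L y (-x - y) ≤
        C * scaleGrowth m L * l2norm volume f * l2norm volume g * l2norm volume h := by
  obtain ⟨C, hC⟩ := lintegral_cubeInd_mul_scaleKernel_le m hθ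
  refine ⟨(C : ℝ≥0) ^ (1 / 2 : ℝ), fun L hL f g h hf hg hh hsupp => ?_⟩
  rw [ENNReal.coe_rpow_of_nonneg _ (by norm_num)]
  have hk : Measurable (Function.uncurry fun x y : SpaceTime (m + 2) =>
      cubeInd (2 * L) 0 y * scaleKernel θ L y (-x - y)) := by
    unfold Function.uncurry
    fun_prop
  refine le_trans (lintegral_mono fun x => lintegral_mono fun y => ?_)
    (lintegral_trilinear_le hf hg hh hk (A := C ^ (1 / 2 : ℝ) * scaleGrowth m L) fun x => ?_)
  · by_cases h0 : g y = 0
    · simp [h0]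
    · rw [cubeInd_zero_eq_one_of_norm_le ((norm_le_bracket _).trans (hsupp y h0)), one_mul]
  · rw [mul_pow, scaleGrowth, ENNReal.rpow_half_sq, ENNReal.rpow_half_sq]
    exact hC 0 L hL x

/-- The trilinear form with the kernel at scale `L`, when the frequency of `f` is `O(L)`. The
frequencies of `g` and `h` are then opposite up to `O(L)`: the form is an average of forms in
which `g` and `h` are localized in opposite cubes of side `O(L)`, and the localized pieces are
almost orthogonal. -/
theorem trilinear_scaleKernel_le_of_low_first (m : ℕ) {θ : ℝ} (hθ : 1 / 2 < θ) :
    ∃ C : ℝ≥0, ∀ (L : ℝ) (_ : 1 ≤ L) (f g h : SpaceTime (m + 2) → ℝ≥0∞) (_ : Measurable f)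
      (_ : Measurable g) (_ : Measurable h) (_ : ∀ x, f x ≠ 0 → bracket x.1 ≤ 2 * L),
      ∫⁻ x, ∫⁻ y, f x * g y * h (-x - y) * scaleKernel θ L y (-x - y) ≤
        C * scaleGrowth m L * l2norm volume f * l2norm volume g * l2norm volume h := by
  obtain ⟨C, hC⟩ := lintegral_cubeInd_mul_scaleKernel_le m hθ
  refine ⟨(C : ℝ≥0) ^ (1 / 2 : ℝ) * ((2 : ℝ≥0) ^ (m + 2)) ^ (1 / 2 : ℝ),
    fun L hL f g h hf hg hh hsupp => ?_⟩
  rw [ENNReal.coe_mul, ENNReal.coe_rpow_of_nonneg _ (by norm_num),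
    ENNReal.coe_rpow_of_nonneg _ (by norm_num)]
  set A := (C : ℝ≥0∞) ^ (1 / 2 : ℝ) * scaleGrowth m L with hA
  set V : ℝ≥0∞ := ENNReal.ofReal (2 * (2 * L)) ^ (m + 2) with hV
  have hV0 : V ≠ 0 := pow_ne_zero _ (by simpa using by linarith)
  have hVt : V ≠ ∞ := by finiteness
  -- the localized pieces of `g` and of `h` add up, in the square, to the volume of the cube
  have hsq : ∀ (R : ℝ) (F : SpaceTime (m + 2) → ℝ≥0∞), Measurable F →
      l2norm volume (fun c => l2norm volume fun y => F y * cubeInd R c y) =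
        (ENNReal.ofReal (2 * R) ^ (m + 2)) ^ (1 / 2 : ℝ) * l2norm volume F := by
    intro R F hF
    conv_lhs => rw [l2norm]
    simp only [l2norm_sq, mul_pow, cubeInd_sq]
    rw [lintegral_lintegral_swap (by fun_prop)]
    have : ∀ y : SpaceTime (m + 2), ∫⁻ c, F y ^ 2 * cubeInd R c y =
        ENNReal.ofReal (2 * R) ^ (m + 2) * F y ^ 2 := fun y => by
      rw [lintegral_const_mul _ (by fun_prop), lintegral_cubeInd, mul_comm]
    rw [lintegral_congr this, lintegral_const_mul _ (by fun_prop),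
      ENNReal.mul_rpow_of_nonneg _ _ (by norm_num), ← l2norm]
  have hl2m : ∀ (R : ℝ) (F : SpaceTime (m + 2) → ℝ≥0∞), Measurable F →
      Measurable fun c : Fin (m + 2) → ℝ => l2norm volume fun y => F y * cubeInd R c y := by
    intro R F hF
    unfold l2norm
    refine Measurable.pow_const (Measurable.lintegral_prod_right ?_) _
    fun_prop
  have hpiece : ∀ c : Fin (m + 2) → ℝ,
      ∫⁻ x, ∫⁻ y, f x * g y * h (-x - y) * scaleKernel θ L y (-x - y) * cubeInd (2 * L) c y ≤
      A * l2norm volume f * (l2norm volume (fun y => g y * cubeInd (2 * L) c y) *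
        l2norm volume (fun y => h y * cubeInd (4 * L) (-c) y)) := by
    intro c
    have hk : Measurable (Function.uncurry fun x y : SpaceTime (m + 2) =>
        cubeInd (2 * L) c y * scaleKernel θ L y (-x - y)) := by
      unfold Function.uncurry
      fun_prop
    have := lintegral_trilinear_le (A := A) hf (g := fun y => g y * cubeInd (2 * L) c y)
      (h := fun y => h y * cubeInd (4 * L) (-c) y) (by fun_prop) (by fun_prop) hk (fun x => by
        rw [hA, mul_pow, scaleGrowth, ENNReal.rpow_half_sq, ENNReal.rpow_half_sq]
        exact hC c L hL x)
    rw [mul_assoc (A * l2norm volume f)] at this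
    refine le_trans (lintegral_mono fun x => lintegral_mono fun y => ?_) this
    by_cases hx : f x = 0
    · simp [hx]
    by_cases hy : ∀ i, |y.1 i - c i| ≤ 2 * L
    · have h1 : cubeInd (2 * L) c y = 1 := cubeInd_eq_one hy
      have h2 : cubeInd (4 * L) (-c) (-x - y) = 1 := by
        refine cubeInd_eq_one fun i => ?_
        have h3 : |x.1 i| ≤ 2 * L :=
          (PiLp.norm_apply_le x.1 i).trans ((norm_le_bracket _).trans (hsupp x hx))
        have h4 := hy i
        simp only [Prod.fst_sub, Prod.fst_neg, PiLp.sub_apply, PiLp.neg_apply, Pi.neg_apply]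
        rw [abs_le] at h3 h4 ⊢
        constructor <;> linarith [h3.1, h3.2, h4.1, h4.2]
      simp [h1, h2]
    · have h1 : cubeInd (2 * L) c y = 0 := by simp [cubeInd, Set.indicator, hy]
      simp [h1]
  have havg : V * ∫⁻ x, ∫⁻ y, f x * g y * h (-x - y) * scaleKernel θ L y (-x - y) =
      ∫⁻ c, ∫⁻ x, ∫⁻ y,
        f x * g y * h (-x - y) * scaleKernel θ L y (-x - y) * cubeInd (2 * L) c y := by
    conv_rhs => rw [lintegral_lintegral_swap (by fun_prop)]
    rw [← lintegral_const_mul _ (by fun_prop)]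
    refine lintegral_congr fun x => ?_
    conv_rhs => rw [lintegral_lintegral_swap (by fun_prop)]
    rw [← lintegral_const_mul _ (by fun_prop)]
    refine lintegral_congr fun y => ?_
    rw [lintegral_const_mul _ (by fun_prop), lintegral_cubeInd, mul_comm]
  have hV2 : (ENNReal.ofReal (2 * (4 * L)) ^ (m + 2)) = 2 ^ (m + 2) * V := by
    rw [hV, ← mul_pow]
    congr 1
    rw [show 2 * (4 * L) = 2 * (2 * (2 * L)) by ring, ENNReal.ofReal_mul zero_le_two,
      ENNReal.ofReal_ofNat]
  have hhneg : l2norm volume (fun c : Fin (m + 2) → ℝ =>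
      l2norm volume fun y => h y * cubeInd (4 * L) (-c) y) =
      l2norm volume (fun c : Fin (m + 2) → ℝ =>
        l2norm volume fun y => h y * cubeInd (4 * L) c y) := by
    conv_lhs => rw [l2norm]
    conv_rhs => rw [l2norm]
    rw [← lintegral_neg_eq_self]
    simp only [neg_neg]
  have hfinal : V * ∫⁻ x, ∫⁻ y, f x * g y * h (-x - y) * scaleKernel θ L y (-x - y) ≤
      V * ((C ^ (1 / 2 : ℝ) * (2 ^ (m + 2)) ^ (1 / 2 : ℝ)) * scaleGrowth m L * l2norm volume f *
        l2norm volume g * l2norm volume h) := by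
    rw [havg]
    refine (lintegral_mono hpiece).trans ?_
    have hm1 := hl2m (2 * L) g hg
    have hm2 : Measurable fun c : Fin (m + 2) → ℝ =>
        l2norm volume fun y => h y * cubeInd (4 * L) (-c) y :=
      (hl2m (4 * L) h hh).comp measurable_neg
    have hm12 : Measurable fun c : Fin (m + 2) → ℝ =>
        l2norm volume (fun y => g y * cubeInd (2 * L) c y) *
          l2norm volume (fun y => h y * cubeInd (4 * L) (-c) y) := hm1.mul hm2
    rw [lintegral_const_mul _ hm12]
    refine (mul_le_mul_right (lintegral_mul_le_l2norm hm1.aemeasurable hm2.aemeasurable) _).trans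
      (le_of_eq ?_)
    rw [hhneg, hsq _ _ hg, hsq _ _ hh, hV2, ← hV, ENNReal.mul_rpow_of_nonneg _ _ (by norm_num), hA]
    conv_rhs => rw [← ENNReal.rpow_half_sq V]
    ring
  exact (ENNReal.mul_le_mul_iff_right hV0 hVt).1 hfinal

end Localized

/-! ### Dyadic decomposition -/

section Dyadic

theorem tsum_pow_sub_le (r : ℝ≥0∞) (l₀ : ℕ) :
    ∑' l, (if l ≤ l₀ then r ^ (l₀ - l) else 0) ≤ (1 - r)⁻¹ := by
  rw [tsum_eq_sum (s := Finset.range (l₀ + 1)) (fun l hl => by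
    rw [Finset.mem_range] at hl
    rw [if_neg (by omega)])]
  rw [← Finset.sum_range_reflect, ← ENNReal.tsum_geometric]
  refine le_trans (Finset.sum_le_sum fun j hj => ?_) (ENNReal.sum_le_tsum (Finset.range (l₀ + 1)))
  rw [Finset.mem_range] at hj
  rw [if_pos (by omega)]
  exact le_of_eq (by congr 1; omega)

/-- Summation of the dyadic gains: the terms `b^a 2^{l c}` with `2^l ≤ b` are dominated by a
geometric series, which decreases away from `2^l ∼ b` if `a < 0`, and from `l = 0` if `c < 0`. -/
theorem exists_tsum_gain_le {a c : ℝ} (ha : a ≤ 0) (hac : a + c ≤ 0) (h : a < 0 ∨ c < 0) :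
    ∃ C : ℝ≥0, ∀ b : ℝ, 1 ≤ b →
      ∑' l : ℕ, (if (2 : ℝ) ^ l ≤ b then ENNReal.ofReal (b ^ a * ((2 : ℝ) ^ l) ^ c) else 0)
        ≤ C := by
  have hr : ∀ e : ℝ, e < 0 → (1 - ENNReal.ofReal (2 ^ e))⁻¹ ≠ ∞ := by
    intro e he
    rw [ENNReal.inv_ne_top]
    have : ENNReal.ofReal (2 ^ e) < 1 := by
      rw [ENNReal.ofReal_lt_one]
      exact Real.rpow_lt_one_of_one_lt_of_neg one_lt_two he
    exact (tsub_pos_of_lt this).ne'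
  rcases h with h | h
  · refine ⟨(1 - ENNReal.ofReal (2 ^ a))⁻¹.toNNReal, fun b hb => ?_⟩
    rw [ENNReal.coe_toNNReal (hr a h)]
    obtain ⟨l₀, h1, h2⟩ := exists_nat_pow_near hb one_lt_two
    refine le_trans (ENNReal.tsum_le_tsum fun l => ?_) (tsum_pow_sub_le _ l₀)
    split_ifs with h3 h4
    · rw [← ENNReal.ofReal_pow (by positivity)]
      refine ENNReal.ofReal_le_ofReal ?_
      have h5 : b ^ a ≤ ((2 : ℝ) ^ l₀) ^ a :=
        Real.rpow_le_rpow_of_nonpos (by positivity) h1 ha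
      have h6 : ((2 : ℝ) ^ l) ^ c ≤ ((2 : ℝ) ^ l) ^ (-a) :=
        Real.rpow_le_rpow_of_exponent_le (one_le_pow₀ one_le_two) (by linarith)
      calc _ ≤ ((2 : ℝ) ^ l₀) ^ a * ((2 : ℝ) ^ l) ^ (-a) := by gcongr
        _ = _ := by
          simp only [← Real.rpow_natCast, ← Real.rpow_mul zero_le_two,
            ← Real.rpow_add zero_lt_two, Nat.cast_sub h4]
          congr 1
          ring
    · exact absurd ((pow_lt_pow_iff_right₀ one_lt_two).1 (h3.trans_lt h2)) (by omega)
    · exact zero_le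
    · exact zero_le
  · refine ⟨(1 - ENNReal.ofReal (2 ^ c))⁻¹.toNNReal, fun b hb => ?_⟩
    rw [ENNReal.coe_toNNReal (hr c h), ← ENNReal.tsum_geometric]
    refine ENNReal.tsum_le_tsum fun l => ?_
    split_ifs
    · rw [← ENNReal.ofReal_pow (by positivity)]
      refine ENNReal.ofReal_le_ofReal ?_
      have h5 : b ^ a ≤ 1 := Real.rpow_le_one_of_one_le_of_nonpos hb ha
      calc _ ≤ 1 * ((2 : ℝ) ^ l) ^ c := by gcongr
        _ = _ := by
          rw [one_mul, ← Real.rpow_natCast, ← Real.rpow_mul zero_le_two,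
            mul_comm, Real.rpow_mul zero_le_two, Real.rpow_natCast]
    · exact zero_le

variable {n : ℕ}

/-- The indicator of the dyadic shell `2^l ≤ ⟨ξ⟩ < 2^{l+1}`. -/
noncomputable def shell (l : ℕ) (x : SpaceTime n) : ℝ≥0∞ :=
  if 2 ^ l ≤ bracket x.1 ∧ bracket x.1 < 2 ^ (l + 1) then 1 else 0

/-- The gain `⟨ξ⟩^α 2^{-kl}` of a function of frequency `⟨ξ⟩ ≥ 2^l` against a function in the
shell of index `l`. -/
noncomputable def shellGain (α k : ℝ) (l : ℕ) (x : SpaceTime n) : ℝ≥0∞ :=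
  if 2 ^ l ≤ bracket x.1 then ENNReal.ofReal (bracket x.1 ^ α * (2 ^ l) ^ (-k)) else 0

@[fun_prop]
theorem measurable_shell (l : ℕ) : Measurable (shell l : SpaceTime n → ℝ≥0∞) := by
  have : Measurable fun x : SpaceTime n => bracket x.1 :=
    (continuous_bracket.comp continuous_fst).measurable
  unfold shell
  refine Measurable.ite ((measurableSet_le measurable_const this).inter
    (measurableSet_lt this measurable_const)) measurable_const measurable_const

@[fun_prop]
theorem measurable_shellGain (α k : ℝ) (l : ℕ) :
    Measurable (shellGain α k l : SpaceTime n → ℝ≥0∞) := by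
  have : Measurable fun x : SpaceTime n => bracket x.1 :=
    (continuous_bracket.comp continuous_fst).measurable
  unfold shellGain
  refine Measurable.ite (measurableSet_le measurable_const this) ?_ measurable_const
  fun_prop

theorem exists_shell (x : SpaceTime n) :
    ∃ l : ℕ, 2 ^ l ≤ bracket x.1 ∧ bracket x.1 < 2 ^ (l + 1) :=
  exists_nat_pow_near (one_le_bracket x.1) one_lt_two

theorem tsum_shell_sq (x : SpaceTime n) : ∑' l, shell l x ^ 2 = 1 := by
  obtain ⟨l, hl⟩ := exists_shell x
  rw [tsum_eq_single l]
  · simp [shell, hl]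
  · intro j hj
    have : ¬ (2 ^ j ≤ bracket x.1 ∧ bracket x.1 < 2 ^ (j + 1)) := by
      rintro ⟨h1, h2⟩
      have h3 := (pow_lt_pow_iff_right₀ (one_lt_two (α := ℝ))).1 (h1.trans_lt hl.2)
      have h4 := (pow_lt_pow_iff_right₀ (one_lt_two (α := ℝ))).1 (hl.1.trans_lt h2)
      omega
    simp [shell, this]

theorem tsum_l2norm_shell_sq {f : SpaceTime n → ℝ≥0∞} (hf : Measurable f) :
    ∑' l, l2norm volume (fun x => f x * shell l x) ^ 2 = l2norm volume f ^ 2 := by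
  simp only [l2norm_sq, mul_pow]
  rw [← lintegral_tsum (fun l => by fun_prop)]
  simp only [ENNReal.tsum_mul_left, tsum_shell_sq, mul_one]

/-- The growth `2^{(m+1)l/2}` of the kernel at scale `2^l` is absorbed, in the square and summed
over `l`, by the gain. -/
theorem exists_tsum_l2norm_shellGain_sq_le (m : ℕ) {α k : ℝ} (ha : α ≤ 0)
    (hac : 2 * α + (m + 1 - 2 * k) ≤ 0) (h : α < 0 ∨ m + 1 - 2 * k < 0) :
    ∃ C : ℝ≥0, ∀ f : SpaceTime n → ℝ≥0∞, Measurable f →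
      ∑' l : ℕ, (scaleGrowth m (2 ^ l) * l2norm volume (fun x => f x * shellGain α k l x)) ^ 2 ≤
        (C * l2norm volume f) ^ 2 := by
  obtain ⟨C, hC⟩ := exists_tsum_gain_le (a := 2 * α) (c := m + 1 - 2 * k) (by linarith) hac
    (h.imp (fun h => by linarith) id)
  refine ⟨C ^ (1 / 2 : ℝ), fun f hf => ?_⟩
  rw [ENNReal.coe_rpow_of_nonneg _ (by norm_num)]
  simp only [mul_pow, l2norm_sq, scaleGrowth, ENNReal.rpow_half_sq]
  simp_rw [← lintegral_const_mul' _ _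
    (ENNReal.pow_ne_top (ENNReal.ofReal_ne_top) : ENNReal.ofReal (2 ^ _) ^ (m + 1) ≠ ∞)]
  rw [← lintegral_tsum (fun l => by fun_prop), ← lintegral_const_mul _ (by fun_prop)]
  refine lintegral_mono fun x => ?_
  have : ∀ l : ℕ, ENNReal.ofReal (2 ^ l) ^ (m + 1) * (f x ^ 2 * shellGain α k l x ^ 2) =
      f x ^ 2 * (if (2 : ℝ) ^ l ≤ bracket x.1 then
        ENNReal.ofReal (bracket x.1 ^ (2 * α) * ((2 : ℝ) ^ l) ^ (m + 1 - 2 * k)) else 0) := by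
    intro l
    rw [mul_left_comm]
    congr 1
    unfold shellGain
    split_ifs
    · have hb := bracket_pos x.1
      have h2 : (0 : ℝ) < 2 ^ l := by positivity
      rw [← ENNReal.ofReal_pow h2.le, ← ENNReal.ofReal_pow (by positivity),
        ← ENNReal.ofReal_mul (by positivity)]
      congr 1
      rw [mul_pow, ← Real.rpow_natCast (bracket x.1 ^ α), ← Real.rpow_mul hb.le,
        ← Real.rpow_natCast (((2 : ℝ) ^ l) ^ (-k)), ← Real.rpow_mul h2.le, mul_left_comm,
        ← Real.rpow_natCast _ (m + 1), ← Real.rpow_add h2]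
      push_cast
      ring_nf
    · simp
  simp only [this, ENNReal.tsum_mul_left]
  rw [mul_comm]
  gcongr
  exact hC _ (one_le_bracket _)

end Dyadic

/-! ### The trilinear estimate -/

section FrequencyWeight

variable {n : ℕ}

/-- The size `(1 + |ξ₁|² + |ξ₂|² + |ξ₃|²)^{1/2}` of a triple of frequencies. -/
noncomputable def maxFreq (x y z : SpaceTime n) : ℝ :=
  Real.sqrt (1 + ‖x.1‖ ^ 2 + ‖y.1‖ ^ 2 + ‖z.1‖ ^ 2)

/-- The smallest bracket of a triple of frequencies. -/
noncomputable def minFreq (x y z : SpaceTime n) : ℝ :=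
  min (bracket x.1) (min (bracket y.1) (bracket z.1))

/-- The weight `N^e L^{-k}`, where `N` and `L` are the largest and the smallest size of the
frequencies in a triple. -/
noncomputable def freqWeight (e k : ℝ) (x y z : SpaceTime n) : ℝ :=
  maxFreq x y z ^ e * minFreq x y z ^ (-k)

theorem freqWeight_swap12 (e k : ℝ) (x y z : SpaceTime n) :
    freqWeight e k x y z = freqWeight e k y x z := by
  unfold freqWeight maxFreq minFreq
  rw [min_left_comm]
  ring_nf

theorem freqWeight_swap23 (e k : ℝ) (x y z : SpaceTime n) :
    freqWeight e k x y z = freqWeight e k x z y := by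
  unfold freqWeight maxFreq minFreq
  rw [min_comm (bracket y.1)]
  ring_nf

theorem bracket_le_maxFreq (x y z : SpaceTime n) :
    bracket x.1 ≤ maxFreq x y z ∧ bracket y.1 ≤ maxFreq x y z ∧ bracket z.1 ≤ maxFreq x y z := by
  unfold bracket maxFreq
  refine ⟨?_, ?_, ?_⟩ <;> refine Real.sqrt_le_sqrt ?_ <;>
    nlinarith [sq_nonneg ‖x.1‖, sq_nonneg ‖y.1‖, sq_nonneg ‖z.1‖]

theorem maxFreq_le (x y z : SpaceTime n) : maxFreq x y z ≤ 1 + ‖x.1‖ + ‖y.1‖ + ‖z.1‖ := by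
  unfold maxFreq
  refine Real.sqrt_le_iff.2 ⟨by positivity, ?_⟩
  nlinarith [norm_nonneg x.1, norm_nonneg y.1, norm_nonneg z.1,
    mul_nonneg (norm_nonneg x.1) (norm_nonneg y.1), mul_nonneg (norm_nonneg x.1) (norm_nonneg z.1),
    mul_nonneg (norm_nonneg y.1) (norm_nonneg z.1)]

theorem one_le_minFreq (x y z : SpaceTime n) : 1 ≤ minFreq x y z :=
  le_min (one_le_bracket _) (le_min (one_le_bracket _) (one_le_bracket _))

@[fun_prop]
theorem measurable_freqWeight (e k : ℝ) :
    Measurable fun q : SpaceTime n × SpaceTime n × SpaceTime n =>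
      freqWeight e k q.1 q.2.1 q.2.2 := by
  have : Measurable fun x : SpaceTime n => bracket x.1 :=
    (continuous_bracket.comp continuous_fst).measurable
  unfold freqWeight maxFreq minFreq
  fun_prop

/-- For frequencies with sum `0`, all of them are controlled by one of them and the difference
of the last two. -/
theorem maxFreq_le_add_norm_sub {x y z : SpaceTime n} (h : x + y + z = 0) :
    maxFreq x y z ≤ 5 * (bracket x.1 + ‖y.1 - z.1‖) ∧
    maxFreq x y z ≤ 5 * (bracket y.1 + ‖y.1 - z.1‖) ∧
    maxFreq x y z ≤ 5 * (bracket z.1 + ‖y.1 - z.1‖) := by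
  have h1 : x.1 + y.1 + z.1 = 0 := congrArg Prod.fst h
  have hN := maxFreq_le x y z
  have hx : ‖x.1‖ ≤ ‖y.1‖ + ‖z.1‖ := by
    have : x.1 = -(y.1 + z.1) := by rw [← add_eq_zero_iff_eq_neg, ← add_assoc, h1]
    rw [this, norm_neg]
    exact norm_add_le _ _
  have hyz : ‖y.1‖ ≤ ‖z.1‖ + ‖y.1 - z.1‖ := by
    have := norm_add_le z.1 (y.1 - z.1)
    rwa [add_sub_cancel] at this
  have hzy : ‖z.1‖ ≤ ‖y.1‖ + ‖y.1 - z.1‖ := by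
    have := norm_sub_le y.1 (y.1 - z.1)
    rwa [sub_sub_cancel] at this
  have hy2 : 2 * ‖y.1‖ ≤ ‖x.1‖ + ‖y.1 - z.1‖ := by
    have h2 : (2 : ℝ) • y.1 = (y.1 - z.1) - x.1 := by
      rw [eq_sub_iff_add_eq, ← sub_eq_zero, ← h1]
      module
    have h3 := norm_sub_le (y.1 - z.1) x.1
    rw [← h2, norm_smul] at h3
    norm_num at h3
    linarith
  have hz2 : 2 * ‖z.1‖ ≤ ‖x.1‖ + ‖y.1 - z.1‖ := by
    have h2 : (2 : ℝ) • z.1 = -(y.1 - z.1) - x.1 := by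
      rw [eq_sub_iff_add_eq, ← sub_eq_zero, ← h1]
      module
    have h3 := norm_sub_le (-(y.1 - z.1)) x.1
    rw [← h2, norm_smul, norm_neg] at h3
    norm_num at h3
    linarith
  have b1 := one_le_bracket x.1
  have b2 := one_le_bracket y.1
  have b3 := one_le_bracket z.1
  have c1 := norm_le_bracket x.1
  have c2 := norm_le_bracket y.1
  have c3 := norm_le_bracket z.1
  have d := norm_nonneg (y.1 - z.1)
  refine ⟨?_, ?_, ?_⟩ <;> linarith

/-- Of the power `N^{α+1/2}` the nonpositive part `N^α` may be moved to the frequency `b`, and the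
remaining `N^{1/2}` is left to the kernel at scale `R`. -/
theorem rpow_mul_rpow_le_of_scale {α k N M b l R : ℝ} (hα : α ≤ 0) (hk : 0 ≤ k) (hl : 1 ≤ l)
    (hlM : l ≤ M) (hb : 1 ≤ b) (hbN : b ≤ N) (hNR : N ≤ 5 * R) :
    N ^ (α + 1 / 2) * M ^ (-k) ≤ 3 * (b ^ α * l ^ (-k) * R ^ (1 / 2 : ℝ)) := by
  have hN : 0 < N := by linarith
  have hR : 0 < R := by linarith
  have h1 : N ^ α ≤ b ^ α := Real.rpow_le_rpow_of_nonpos (by linarith) hbN hα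
  have h2 : M ^ (-k) ≤ l ^ (-k) := Real.rpow_le_rpow_of_nonpos (by linarith) hlM (by linarith)
  have h3 : N ^ (1 / 2 : ℝ) ≤ 3 * R ^ (1 / 2 : ℝ) := by
    rw [← Real.sqrt_eq_rpow, ← Real.sqrt_eq_rpow]
    refine Real.sqrt_le_iff.2 ⟨by positivity, ?_⟩
    rw [mul_pow, Real.sq_sqrt hR.le]
    linarith
  have h4 : 0 ≤ M ^ (-k) := Real.rpow_nonneg (by linarith) _
  have h5 : 0 ≤ l ^ (-k) := Real.rpow_nonneg (by linarith) _
  have h6 : 0 ≤ b ^ α := Real.rpow_nonneg (by linarith) _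
  rw [Real.rpow_add hN]
  calc N ^ α * N ^ (1 / 2 : ℝ) * M ^ (-k) ≤ b ^ α * (3 * R ^ (1 / 2 : ℝ)) * l ^ (-k) := by
        gcongr
    _ = _ := by ring

/-- The frequency weight is dominated by its dyadic decomposition with respect to the smallest
frequency. -/
theorem ofReal_freqWeight_le {α k : ℝ} (hα : α ≤ 0) (hk : 0 ≤ k) {x y z : SpaceTime n}
    (h : x + y + z = 0) :
    ENNReal.ofReal (freqWeight (α + 1 / 2) k x y z) ≤
      3 * ∑' l : ℕ, (shell l x * shellGain α k l y + shellGain α k l x * shell l y +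
        shellGain α k l x * shell l z) *
          ENNReal.ofReal (2 * 2 ^ l + ‖y.1 - z.1‖) ^ (1 / 2 : ℝ) := by
  -- `w` has the smallest frequency, and `v` carries the gain
  have key : ∀ (v w : SpaceTime n), bracket w.1 = minFreq x y z → bracket w.1 ≤ bracket v.1 →
      bracket v.1 ≤ maxFreq x y z → maxFreq x y z ≤ 5 * (bracket w.1 + ‖y.1 - z.1‖) →
      ∃ l : ℕ, ENNReal.ofReal (freqWeight (α + 1 / 2) k x y z) ≤
        3 * ((shellGain α k l v * shell l w) *
          ENNReal.ofReal (2 * 2 ^ l + ‖y.1 - z.1‖) ^ (1 / 2 : ℝ)) := by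
    intro v w hw hwv hv hN
    obtain ⟨l, hl⟩ := exists_shell w
    refine ⟨l, ?_⟩
    have h1 : shell l w = 1 := by simp [shell, hl]
    have hb := bracket_pos v.1
    have h2 : (0 : ℝ) ≤ bracket v.1 ^ α * (2 ^ l) ^ (-k) := by positivity
    rw [h1, mul_one, shellGain, if_pos (hl.1.trans hwv),
      ENNReal.ofReal_rpow_of_nonneg (by positivity) (by norm_num), ← ENNReal.ofReal_mul h2,
      ← ENNReal.ofReal_ofNat 3, ← ENNReal.ofReal_mul (by norm_num)]
    refine ENNReal.ofReal_le_ofReal ?_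
    refine rpow_mul_rpow_le_of_scale hα hk (one_le_pow₀ one_le_two) (hl.1.trans hw.le)
      (one_le_bracket _) hv (hN.trans ?_)
    have := hl.2
    rw [pow_succ] at this
    linarith
  obtain ⟨hx, hy, hz⟩ := bracket_le_maxFreq x y z
  obtain ⟨hNx, hNy, hNz⟩ := maxFreq_le_add_norm_sub h
  have hmin : minFreq x y z = min (bracket x.1) (min (bracket y.1) (bracket z.1)) := rfl
  have hxy : minFreq x y z ≤ bracket x.1 := min_le_left _ _
  have hyy : minFreq x y z ≤ bracket y.1 := (min_le_right _ _).trans (min_le_left _ _)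
  have hcases : bracket x.1 = minFreq x y z ∨ bracket y.1 = minFreq x y z ∨
      bracket z.1 = minFreq x y z := by
    rcases min_choice (bracket x.1) (min (bracket y.1) (bracket z.1)) with h1 | h1
    · exact Or.inl (hmin.trans h1).symm
    · rcases min_choice (bracket y.1) (bracket z.1) with h2 | h2
      · exact Or.inr (Or.inl (hmin.trans (h1.trans h2)).symm)
      · exact Or.inr (Or.inr (hmin.trans (h1.trans h2)).symm)
  rcases hcases with h0 | h0 | h0
  · obtain ⟨l, hl⟩ := key y x h0 (h0.trans_le hyy) hy hNx
    refine hl.trans (mul_le_mul_right (le_trans ?_ (ENNReal.le_tsum l)) _)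
    gcongr
    rw [mul_comm, add_assoc]
    exact le_self_add
  · obtain ⟨l, hl⟩ := key x y h0 (h0.trans_le hxy) hx hNy
    refine hl.trans (mul_le_mul_right (le_trans ?_ (ENNReal.le_tsum l)) _)
    gcongr
    rw [add_right_comm]
    exact le_add_self
  · obtain ⟨l, hl⟩ := key x z h0 (h0.trans_le hxy) hx hNz
    refine hl.trans (mul_le_mul_right (le_trans ?_ (ENNReal.le_tsum l)) _)
    gcongr
    exact le_add_self

end FrequencyWeight

section TrilinearEstimate

/-- The trilinear estimate with the two modulation weights of `y` and `z`. -/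
theorem exists_trilinear_freqWeight_le (m : ℕ) {θ α k : ℝ} (hθ : 1 / 2 < θ) (hk : 0 ≤ k)
    (ha : α ≤ 0) (hac : 2 * α + (m + 1 - 2 * k) ≤ 0) (hneg : α < 0 ∨ m + 1 - 2 * k < 0) :
    ∃ C : ℝ≥0, ∀ f g h : SpaceTime (m + 2) → ℝ≥0∞, Measurable f → Measurable g → Measurable h →
      ∫⁻ x, ∫⁻ y, f x * g y * h (-x - y) *
        (ENNReal.ofReal (freqWeight (α + 1 / 2) k x y (-x - y)) *
          (modDecay θ y * modDecay θ (-x - y))) ≤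
        C * (l2norm volume f * l2norm volume g * l2norm volume h) := by
  obtain ⟨C₁, hC₁⟩ := trilinear_scaleKernel_le_of_low_first m hθ
  obtain ⟨C₂, hC₂⟩ := trilinear_scaleKernel_le_of_low_second m hθ
  obtain ⟨D, hD⟩ := exists_tsum_l2norm_shellGain_sq_le (n := m + 2) m ha hac hneg
  -- the three parts of the dyadic decomposition
  let I₁ : ℕ → (SpaceTime (m + 2) → ℝ≥0∞) → (SpaceTime (m + 2) → ℝ≥0∞) →
      (SpaceTime (m + 2) → ℝ≥0∞) → ℝ≥0∞ := fun l f g h => ∫⁻ x, ∫⁻ y,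
    (f x * shell l x) * (g y * shellGain α k l y) * h (-x - y) *
      scaleKernel θ (2 ^ l) y (-x - y)
  let I₂ : ℕ → (SpaceTime (m + 2) → ℝ≥0∞) → (SpaceTime (m + 2) → ℝ≥0∞) →
      (SpaceTime (m + 2) → ℝ≥0∞) → ℝ≥0∞ := fun l f g h => ∫⁻ x, ∫⁻ y,
    (f x * shellGain α k l x) * (g y * shell l y) * h (-x - y) *
      scaleKernel θ (2 ^ l) y (-x - y)
  have hshell : ∀ (F : SpaceTime (m + 2) → ℝ≥0∞) (l : ℕ) (x : SpaceTime (m + 2)),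
      F x * shell l x ≠ 0 → bracket x.1 ≤ 2 * 2 ^ l := by
    intro F l x hx
    have h1 : shell l x ≠ 0 := right_ne_zero_of_mul hx
    unfold shell at h1
    split_ifs at h1 with h2
    · rw [pow_succ] at h2
      linarith [h2.2]
    · exact absurd rfl h1
  have hone : ∀ l : ℕ, (1 : ℝ) ≤ 2 ^ l := fun l => one_le_pow₀ one_le_two
  have hI₁ : ∀ f g h, Measurable f → Measurable g → Measurable h →
      ∑' l, I₁ l f g h ≤ C₁ * D * (l2norm volume f * l2norm volume g * l2norm volume h) := by
    intro f g h hf hg hh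
    have h1 : ∀ l, I₁ l f g h ≤ C₁ * l2norm volume h * (l2norm volume (fun x => f x * shell l x) *
        (scaleGrowth m (2 ^ l) * l2norm volume (fun x => g x * shellGain α k l x))) := fun l =>
      (hC₁ (2 ^ l) (hone l) (fun x => f x * shell l x) (fun y => g y * shellGain α k l y) h
        (by fun_prop) (by fun_prop) hh (hshell f l)).trans (le_of_eq (by ring))
    refine (ENNReal.tsum_le_tsum h1).trans ?_
    rw [ENNReal.tsum_mul_left]
    calc _ ≤ C₁ * l2norm volume h * (l2norm volume f * (D * l2norm volume g)) :=
          mul_le_mul_right (tsum_mul_le_of_tsum_sq_le (tsum_l2norm_shell_sq hf).le (hD g hg)) _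
      _ = _ := by ring
  have hI₂ : ∀ f g h, Measurable f → Measurable g → Measurable h →
      ∑' l, I₂ l f g h ≤ C₂ * D * (l2norm volume f * l2norm volume g * l2norm volume h) := by
    intro f g h hf hg hh
    have h1 : ∀ l, I₂ l f g h ≤ C₂ * l2norm volume h * (l2norm volume (fun x => g x * shell l x) *
        (scaleGrowth m (2 ^ l) * l2norm volume (fun x => f x * shellGain α k l x))) := fun l =>
      (hC₂ (2 ^ l) (hone l) (fun x => f x * shellGain α k l x) (fun y => g y * shell l y) h
        (by fun_prop) (by fun_prop) hh (hshell g l)).trans (le_of_eq (by ring))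
    refine (ENNReal.tsum_le_tsum h1).trans ?_
    rw [ENNReal.tsum_mul_left]
    calc _ ≤ C₂ * l2norm volume h * (l2norm volume g * (D * l2norm volume f)) :=
          mul_le_mul_right (tsum_mul_le_of_tsum_sq_le (tsum_l2norm_shell_sq hg).le (hD f hf)) _
      _ = _ := by ring
  refine ⟨3 * (C₁ * D + C₂ * D + C₂ * D), fun f g h hf hg hh => ?_⟩
  -- the part where `z` has the smallest frequency, by the reflection `y ↦ -x - y`
  have hI₃ : ∀ l, ∫⁻ x, ∫⁻ y, (f x * shellGain α k l x) * g y *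
      (h (-x - y) * shell l (-x - y)) * scaleKernel θ (2 ^ l) y (-x - y) = I₂ l f h g := by
    intro l
    refine lintegral_congr fun x => ?_
    rw [← lintegral_sub_left_eq_self _ (-x)]
    refine lintegral_congr fun y => ?_
    rw [sub_sub_cancel, scaleKernel, scaleKernel, norm_sub_rev y.1]
    ring
  have hpt : ∀ x y, f x * g y * h (-x - y) *
        (ENNReal.ofReal (freqWeight (α + 1 / 2) k x y (-x - y)) *
          (modDecay θ y * modDecay θ (-x - y))) ≤
      3 * ∑' l : ℕ, ((f x * shell l x) * (g y * shellGain α k l y) * h (-x - y) *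
          scaleKernel θ (2 ^ l) y (-x - y) +
        (f x * shellGain α k l x) * (g y * shell l y) * h (-x - y) *
          scaleKernel θ (2 ^ l) y (-x - y) +
        (f x * shellGain α k l x) * g y * (h (-x - y) * shell l (-x - y)) *
          scaleKernel θ (2 ^ l) y (-x - y)) := by
    intro x y
    have := ofReal_freqWeight_le ha hk (x := x) (y := y) (z := -x - y) (by abel)
    calc _ ≤ f x * g y * h (-x - y) * ((3 * ∑' l : ℕ, (shell l x * shellGain α k l y +
            shellGain α k l x * shell l y + shellGain α k l x * shell l (-x - y)) *
          ENNReal.ofReal (2 * 2 ^ l + ‖y.1 - (-x - y).1‖) ^ (1 / 2 : ℝ)) *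
            (modDecay θ y * modDecay θ (-x - y))) := by gcongr
      _ = 3 * ((f x * g y * h (-x - y) * (modDecay θ y * modDecay θ (-x - y))) *
          ∑' l : ℕ, (shell l x * shellGain α k l y +
            shellGain α k l x * shell l y + shellGain α k l x * shell l (-x - y)) *
          ENNReal.ofReal (2 * 2 ^ l + ‖y.1 - (-x - y).1‖) ^ (1 / 2 : ℝ)) := by ring
      _ = _ := by
          rw [← ENNReal.tsum_mul_left]
          congr 2 with l
          unfold scaleKernel
          ring
  calc _ ≤ ∫⁻ x, ∫⁻ y, 3 * ∑' l : ℕ, ((f x * shell l x) * (g y * shellGain α k l y) * h (-x - y) *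
          scaleKernel θ (2 ^ l) y (-x - y) +
        (f x * shellGain α k l x) * (g y * shell l y) * h (-x - y) *
          scaleKernel θ (2 ^ l) y (-x - y) +
        (f x * shellGain α k l x) * g y * (h (-x - y) * shell l (-x - y)) *
          scaleKernel θ (2 ^ l) y (-x - y)) :=
        lintegral_mono fun x => lintegral_mono fun y => hpt x y
    _ = 3 * (∑' l, I₁ l f g h + ∑' l, I₂ l f g h + ∑' l, I₂ l f h g) := by
        simp_rw [← hI₃, ← ENNReal.tsum_add]
        simp only [lintegral_const_mul' _ _ (ENNReal.ofNat_ne_top (n := 3))]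
        congr 1
        calc _ = ∫⁻ x, ∑' l : ℕ, ∫⁻ y, ((f x * shell l x) * (g y * shellGain α k l y) * h (-x - y) *
                scaleKernel θ (2 ^ l) y (-x - y) +
              (f x * shellGain α k l x) * (g y * shell l y) * h (-x - y) *
                scaleKernel θ (2 ^ l) y (-x - y) +
              (f x * shellGain α k l x) * g y * (h (-x - y) * shell l (-x - y)) *
                scaleKernel θ (2 ^ l) y (-x - y)) :=
              lintegral_congr fun x => lintegral_tsum fun l => by fun_prop
          _ = _ := by
              rw [lintegral_tsum fun l => by
                refine (Measurable.lintegral_prod_right ?_).aemeasurable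
                fun_prop]
              congr 1 with l
              simp only [I₁, I₂]
              rw [← lintegral_add_left (by
                  refine Measurable.lintegral_prod_right ?_
                  fun_prop),
                ← lintegral_add_left (by
                  refine Measurable.add ?_ ?_ <;> refine Measurable.lintegral_prod_right ?_ <;>
                  fun_prop)]
              refine lintegral_congr fun x => ?_
              rw [lintegral_add_left (by fun_prop), lintegral_add_left (by fun_prop)]
    _ ≤ 3 * (C₁ * D * (l2norm volume f * l2norm volume g * l2norm volume h) +
          C₂ * D * (l2norm volume f * l2norm volume g * l2norm volume h) +
          C₂ * D * (l2norm volume f * l2norm volume h * l2norm volume g)) := by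
        gcongr
        · exact hI₁ f g h hf hg hh
        · exact hI₂ f g h hf hg hh
        · exact hI₂ f h g hf hh hg
    _ = _ := by
        push_cast
        ring

end TrilinearEstimate

/-! ### The bilinear estimate on the Fourier side -/

section BilinearEstimate

variable {n : ℕ}

/-- The weight `⟨ξ⟩^s ⟨τ - |ξ|²⟩^θ`. -/
noncomputable def bourgainWeight (s θ : ℝ) (ζ : SpaceTime n) : ℝ :=
  bracket ζ.1 ^ s * bracket (ζ.2 - ‖ζ.1‖ ^ 2) ^ θ

theorem bourgainWeight_pos (s θ : ℝ) (ζ : SpaceTime n) : 0 < bourgainWeight s θ ζ :=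
  mul_pos (Real.rpow_pos_of_pos (bracket_pos _) _) (Real.rpow_pos_of_pos (bracket_pos _) _)

theorem bourgainWeight_mul_neg (s θ : ℝ) (ζ : SpaceTime n) :
    bourgainWeight s θ ζ * bourgainWeight (-s) (-θ) ζ = 1 := by
  unfold bourgainWeight
  rw [Real.rpow_neg (bracket_pos _).le, Real.rpow_neg (bracket_pos _).le]
  have h1 := (Real.rpow_pos_of_pos (bracket_pos ζ.1) s).ne'
  have h2 := (Real.rpow_pos_of_pos (bracket_pos (ζ.2 - ‖ζ.1‖ ^ 2)) θ).ne'
  field_simp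

@[fun_prop]
theorem continuous_bourgainWeight (s θ : ℝ) :
    Continuous (bourgainWeight s θ : SpaceTime n → ℝ) := by
  unfold bourgainWeight
  refine Continuous.mul ?_ ?_
  · exact Continuous.rpow_const (by fun_prop) fun ζ => Or.inl (bracket_pos _).ne'
  · exact Continuous.rpow_const (by fun_prop) fun ζ => Or.inl (bracket_pos _).ne'

@[fun_prop]
theorem measurable_bourgainWeight (s θ : ℝ) :
    Measurable (bourgainWeight s θ : SpaceTime n → ℝ) :=
  (continuous_bourgainWeight s θ).measurable

/-- If the output has the largest modulation `s`, the weight `s^{θ-1}` is a gain of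
`N^{2θ-2}`. -/
theorem rpow_le_of_sq_le {θ N s : ℝ} (hθ : 1 / 2 < θ) (hθ1 : θ ≤ 1) (hN : 1 ≤ N)
    (h : N ^ 2 ≤ 6 * s) : s ^ (θ - 1) ≤ 6 * N ^ (2 * θ - 2) := by
  have hN0 : 0 < N := by linarith
  calc s ^ (θ - 1) ≤ (N ^ 2 / 6) ^ (θ - 1) :=
        Real.rpow_le_rpow_of_nonpos (by positivity) (by linarith) (by linarith)
    _ = 6 ^ (1 - θ) * N ^ (2 * θ - 2) := by
        rw [Real.div_rpow (by positivity) (by norm_num), ← Real.rpow_natCast,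
          ← Real.rpow_mul hN0.le,
          div_eq_mul_inv, ← Real.rpow_neg (by norm_num), mul_comm]
        congr 2 <;> push_cast <;> ring
    _ ≤ 6 ^ (1 : ℝ) * N ^ (2 * θ - 2) := by
        gcongr
        · norm_num
        · linarith
    _ = _ := by rw [Real.rpow_one]

/-- If an input has the largest modulation `s`, its weight `s^{-θ}` and the weight `t^{θ-1}` of the
output are exchanged for `t^{-θ}` and a gain of `N^{2θ-2}`. -/
theorem rpow_mul_rpow_le_of_le {θ N s t : ℝ} (hθ : 1 / 2 < θ) (hθ1 : θ ≤ 1) (hN : 1 ≤ N)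
    (ht : 1 ≤ t) (hts : t ≤ s) (h : N ^ 2 ≤ 6 * s) :
    t ^ (θ - 1) * s ^ (-θ) ≤ 6 * N ^ (2 * θ - 2) * t ^ (-θ) := by
  have ht0 : 0 < t := by linarith
  have hs0 : 0 < s := by linarith
  have h1 : s ^ (-θ) = s ^ (θ - 1) * s ^ (-(2 * θ - 1)) := by
    rw [← Real.rpow_add hs0]
    congr 1
    ring
  have h2 : t ^ (-θ) = t ^ (θ - 1) * t ^ (-(2 * θ - 1)) := by
    rw [← Real.rpow_add ht0]
    congr 1
    ring
  have h3 : s ^ (-(2 * θ - 1)) ≤ t ^ (-(2 * θ - 1)) :=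
    Real.rpow_le_rpow_of_nonpos ht0 hts (by linarith)
  have h4 := rpow_le_of_sq_le hθ hθ1 hN h
  rw [h1, h2]
  calc t ^ (θ - 1) * (s ^ (θ - 1) * s ^ (-(2 * θ - 1)))
      ≤ t ^ (θ - 1) * (6 * N ^ (2 * θ - 2) * t ^ (-(2 * θ - 1))) := by gcongr
    _ = _ := by ring

/-- Absence of resonance: over `x + y + z = 0` the modulations `τ - |ξ|²` add up to
`-(|ξ_x|² + |ξ_y|² + |ξ_z|²)`, so the largest one is at least a multiple of the square of the
largest frequency. The weight of the largest modulation is traded for powers of frequencies. -/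
theorem bourgainWeight_mul_le {θ k : ℝ} (hθ : 1 / 2 < θ) (hθ1 : θ ≤ 1) (hk : 0 ≤ k)
    {x y z : SpaceTime n} (h : x + y + z = 0) :
    bourgainWeight (-k) (θ - 1) x * bourgainWeight k (-θ) y * bourgainWeight k (-θ) z ≤
      6 * freqWeight (2 * k + 2 * θ - 2) k x y z *
        (bracket (y.2 - ‖y.1‖ ^ 2) ^ (-θ) * bracket (z.2 - ‖z.1‖ ^ 2) ^ (-θ) +
          bracket (x.2 - ‖x.1‖ ^ 2) ^ (-θ) * bracket (z.2 - ‖z.1‖ ^ 2) ^ (-θ) +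
          bracket (x.2 - ‖x.1‖ ^ 2) ^ (-θ) * bracket (y.2 - ‖y.1‖ ^ 2) ^ (-θ)) := by
  have h2 : x.2 + y.2 + z.2 = 0 := congrArg Prod.snd h
  have hNsq : maxFreq x y z ^ 2 = 1 + ‖x.1‖ ^ 2 + ‖y.1‖ ^ 2 + ‖z.1‖ ^ 2 :=
    Real.sq_sqrt (by positivity)
  have hLx : minFreq x y z ≤ bracket x.1 := min_le_left _ _
  have hL1 := one_le_minFreq x y z
  obtain ⟨hbx, hby, hbz⟩ := bracket_le_maxFreq x y z
  have hN1 : 1 ≤ maxFreq x y z := (one_le_bracket _).trans hbx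
  have hsx := one_le_bracket (x.2 - ‖x.1‖ ^ 2)
  have hsy := one_le_bracket (y.2 - ‖y.1‖ ^ 2)
  have hsz := one_le_bracket (z.2 - ‖z.1‖ ^ 2)
  have hax := (neg_le_abs _).trans (norm_le_bracket (x.2 - ‖x.1‖ ^ 2))
  have hay := (neg_le_abs _).trans (norm_le_bracket (y.2 - ‖y.1‖ ^ 2))
  have haz := (neg_le_abs _).trans (norm_le_bracket (z.2 - ‖z.1‖ ^ 2))
  have hy1 := one_le_bracket y.1
  have hz1 := one_le_bracket z.1
  have hfw : freqWeight (2 * k + 2 * θ - 2) k x y z =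
      maxFreq x y z ^ (2 * θ - 2) * (maxFreq x y z ^ k * maxFreq x y z ^ k) *
        minFreq x y z ^ (-k) := by
    have hN0 : 0 < maxFreq x y z := by linarith
    rw [freqWeight, ← Real.rpow_add hN0, ← Real.rpow_add hN0]
    congr 2
    ring
  rw [hfw]
  unfold bourgainWeight
  generalize maxFreq x y z = N at *
  generalize minFreq x y z = L at *
  generalize bracket (x.2 - ‖x.1‖ ^ 2) = sx at *
  generalize bracket (y.2 - ‖y.1‖ ^ 2) = sy at *
  generalize bracket (z.2 - ‖z.1‖ ^ 2) = sz at *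
  generalize bracket x.1 = bx at *
  generalize bracket y.1 = b₂ at *
  generalize bracket z.1 = b₃ at *
  have hsum : N ^ 2 ≤ 2 * (sx + sy + sz) := by
    by_cases hN2 : N ^ 2 ≤ 2
    · linarith
    · nlinarith
  have hfreq : bx ^ (-k) * (b₂ ^ k * b₃ ^ k) ≤ L ^ (-k) * (N ^ k * N ^ k) := by
    have h3 : bx ^ (-k) ≤ L ^ (-k) := Real.rpow_le_rpow_of_nonpos (by linarith) hLx (by linarith)
    have h4 : b₂ ^ k ≤ N ^ k := Real.rpow_le_rpow (by linarith) hby hk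
    have h5 : b₃ ^ k ≤ N ^ k := Real.rpow_le_rpow (by linarith) hbz hk
    have h6 : 0 ≤ N ^ k := Real.rpow_nonneg (by linarith) _
    have h7 : 0 ≤ b₃ ^ k := Real.rpow_nonneg (by linarith) _
    have h8 : 0 ≤ b₂ ^ k := Real.rpow_nonneg (by linarith) _
    have h9 : 0 ≤ L ^ (-k) := Real.rpow_nonneg (by linarith) _
    gcongr
  have hmod : sx ^ (θ - 1) * (sy ^ (-θ) * sz ^ (-θ)) ≤ 6 * N ^ (2 * θ - 2) *
      (sy ^ (-θ) * sz ^ (-θ) + sx ^ (-θ) * sz ^ (-θ) + sx ^ (-θ) * sy ^ (-θ)) := by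
    have p1 : 0 ≤ sx ^ (-θ) := Real.rpow_nonneg (by linarith) _
    have p2 : 0 ≤ sy ^ (-θ) := Real.rpow_nonneg (by linarith) _
    have p3 : 0 ≤ sz ^ (-θ) := Real.rpow_nonneg (by linarith) _
    have p4 : 0 ≤ 6 * N ^ (2 * θ - 2) := mul_nonneg (by norm_num) (Real.rpow_nonneg (by linarith) _)
    rw [mul_add, mul_add]
    have q1 := mul_nonneg p4 (mul_nonneg p2 p3)
    have q2 := mul_nonneg p4 (mul_nonneg p1 p3)
    have q3 := mul_nonneg p4 (mul_nonneg p1 p2)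
    by_cases c1 : sy ≤ sx ∧ sz ≤ sx
    · have := mul_le_mul_of_nonneg_right (rpow_le_of_sq_le hθ hθ1 hN1 (s := sx) (by linarith))
        (mul_nonneg p2 p3)
      linarith
    by_cases c2 : sx ≤ sy ∧ sz ≤ sy
    · have := mul_le_mul_of_nonneg_right
        (rpow_mul_rpow_le_of_le hθ hθ1 hN1 hsx c2.1 (by linarith)) p3
      linarith
    · have c3 : sx ≤ sz ∧ sy ≤ sz := by
        rcases le_total sx sy with d1 | d1 <;> rcases le_total sx sz with d2 | d2 <;>
          rcases le_total sy sz with d3 | d3 <;> simp_all <;> linarith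
      have := mul_le_mul_of_nonneg_right
        (rpow_mul_rpow_le_of_le hθ hθ1 hN1 hsx c3.1 (by linarith)) p2
      linarith
  have hnn : 0 ≤ sx ^ (θ - 1) * (sy ^ (-θ) * sz ^ (-θ)) :=
    mul_nonneg (Real.rpow_nonneg (by linarith) _)
      (mul_nonneg (Real.rpow_nonneg (by linarith) _) (Real.rpow_nonneg (by linarith) _))
  have hnn2 : 0 ≤ L ^ (-k) * (N ^ k * N ^ k) :=
    mul_nonneg (Real.rpow_nonneg (by linarith) _)
      (mul_nonneg (Real.rpow_nonneg (by linarith) _) (Real.rpow_nonneg (by linarith) _))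
  have := mul_le_mul hfreq hmod hnn hnn2
  calc _ = bx ^ (-k) * (b₂ ^ k * b₃ ^ k) * (sx ^ (θ - 1) * (sy ^ (-θ) * sz ^ (-θ))) := by ring
    _ ≤ _ := this
    _ = _ := by ring

theorem ofReal_bourgainWeight_mul_le {θ k : ℝ} (hθ : 1 / 2 < θ) (hθ1 : θ ≤ 1) (hk : 0 ≤ k)
    {x y z : SpaceTime n} (h : x + y + z = 0) :
    ENNReal.ofReal (bourgainWeight (-k) (θ - 1) x) * ENNReal.ofReal (bourgainWeight k (-θ) y) *
        ENNReal.ofReal (bourgainWeight k (-θ) z) ≤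
      6 * ENNReal.ofReal (freqWeight (2 * k + 2 * θ - 2) k x y z) *
        (modDecay θ y * modDecay θ z + modDecay θ x * modDecay θ z +
          modDecay θ x * modDecay θ y) := by
  have hp : ∀ w : SpaceTime n, 0 ≤ bracket (w.2 - ‖w.1‖ ^ 2) ^ (-θ) := fun w =>
    Real.rpow_nonneg (bracket_pos _).le _
  have hfw : 0 ≤ freqWeight (2 * k + 2 * θ - 2) k x y z :=
    mul_nonneg (Real.rpow_nonneg (Real.sqrt_nonneg _) _)
      (Real.rpow_nonneg (by linarith [one_le_minFreq x y z]) _)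
  have h1 := ENNReal.ofReal_le_ofReal (bourgainWeight_mul_le hθ hθ1 hk h)
  have hx := hp x
  have hy := hp y
  have hz := hp z
  rw [ENNReal.ofReal_mul (mul_nonneg (bourgainWeight_pos _ _ _).le (bourgainWeight_pos _ _ _).le),
    ENNReal.ofReal_mul (bourgainWeight_pos _ _ _).le, ENNReal.ofReal_mul (by positivity),
    ENNReal.ofReal_mul (by norm_num), ENNReal.ofReal_add (by positivity) (by positivity),
    ENNReal.ofReal_add (by positivity) (by positivity), ENNReal.ofReal_mul hy,
    ENNReal.ofReal_mul hx, ENNReal.ofReal_mul hx, ENNReal.ofReal_ofNat] at h1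
  exact h1

/-- The bilinear estimate on the Fourier side. -/
theorem exists_l2norm_bilinear_le (m : ℕ) {θ k : ℝ} (hθ : 1 / 2 < θ) (hθ1 : θ ≤ 1) (hk : 0 ≤ k)
    (ha : 4 * k + 4 * θ - 5 ≤ 0) (hac : 2 * k + 4 * θ + m - 4 ≤ 0)
    (hneg : 4 * k + 4 * θ - 5 < 0 ∨ m + 1 - 2 * k < 0) :
    ∃ C : ℝ≥0, ∀ F G : SpaceTime (m + 2) → ℝ≥0∞, Measurable F → Measurable G →
      l2norm volume (fun ζ => ENNReal.ofReal (bourgainWeight (-k) (θ - 1) ζ) *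
        ∫⁻ η, F η * G (-ζ - η)) ≤
      C * (l2norm volume (fun ζ => ENNReal.ofReal (bourgainWeight (-k) θ ζ) * F ζ) *
        l2norm volume (fun ζ => ENNReal.ofReal (bourgainWeight (-k) θ ζ) * G ζ)) := by
  -- the exponent `2k + 2θ - 2` of the largest frequency is `α + 1/2`
  obtain ⟨C, hC⟩ := exists_trilinear_freqWeight_le m (α := 2 * k + 2 * θ - 5 / 2) hθ hk
    (by linarith)
    (by linarith) (hneg.imp (fun h => by linarith) id)
  have he : 2 * k + 2 * θ - 5 / 2 + 1 / 2 = 2 * k + 2 * θ - 2 := by ring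
  rw [he] at hC
  refine ⟨18 * C, fun F G hF hG => ?_⟩
  refine l2norm_le_of_forall_lintegral_mul_le ?_ fun f hf => ?_
  · refine Measurable.mul (by fun_prop) (Measurable.lintegral_prod_right ?_)
    fun_prop
  set g : SpaceTime (m + 2) → ℝ≥0∞ := fun ζ => ENNReal.ofReal (bourgainWeight (-k) θ ζ) * F ζ
    with hg_def
  set h : SpaceTime (m + 2) → ℝ≥0∞ := fun ζ => ENNReal.ofReal (bourgainWeight (-k) θ ζ) * G ζ
    with hh_def
  have hg : Measurable g := by fun_prop
  have hh : Measurable h := by fun_prop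
  have hinv : ∀ (E : SpaceTime (m + 2) → ℝ≥0∞) (ζ : SpaceTime (m + 2)),
      E ζ = ENNReal.ofReal (bourgainWeight (-k) θ ζ) * E ζ *
        ENNReal.ofReal (bourgainWeight k (-θ) ζ) := by
    intro E ζ
    have := bourgainWeight_mul_neg (-k) θ ζ
    rw [neg_neg] at this
    rw [mul_right_comm, ← ENNReal.ofReal_mul (bourgainWeight_pos _ _ _).le, this,
      ENNReal.ofReal_one,
      one_mul]
  have hpt : ∀ x y, f x * ENNReal.ofReal (bourgainWeight (-k) (θ - 1) x) * (F y * G (-x - y)) ≤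
      6 * (f x * g y * h (-x - y) *
          (ENNReal.ofReal (freqWeight (2 * k + 2 * θ - 2) k x y (-x - y)) *
          (modDecay θ y * modDecay θ (-x - y))) +
        f x * g y * h (-x - y) * (ENNReal.ofReal (freqWeight (2 * k + 2 * θ - 2) k x y (-x - y)) *
          (modDecay θ x * modDecay θ (-x - y))) +
        f x * g y * h (-x - y) * (ENNReal.ofReal (freqWeight (2 * k + 2 * θ - 2) k x y (-x - y)) *
          (modDecay θ x * modDecay θ y))) := by
    intro x y
    rw [hinv F y, hinv G (-x - y)]
    calc _ = f x * g y * h (-x - y) * (ENNReal.ofReal (bourgainWeight (-k) (θ - 1) x) *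
          ENNReal.ofReal (bourgainWeight k (-θ) y) *
          ENNReal.ofReal (bourgainWeight k (-θ) (-x - y))) := by
          simp only [hg_def, hh_def]
          ring
      _ ≤ f x * g y * h (-x - y) * (6 * ENNReal.ofReal (freqWeight (2 * k + 2 * θ - 2) k x y
            (-x - y)) * (modDecay θ y * modDecay θ (-x - y) + modDecay θ x * modDecay θ (-x - y) +
          modDecay θ x * modDecay θ y)) := by
          exact mul_le_mul_right (ofReal_bourgainWeight_mul_le hθ hθ1 hk (x := x) (y := y)
            (z := -x - y) (by abel)) _
      _ = _ := by ring
  -- the trilinear form is invariant under permutations of the three variables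
  have hswap : ∀ f g h : SpaceTime (m + 2) → ℝ≥0∞, Measurable f → Measurable g → Measurable h →
      ∫⁻ x, ∫⁻ y, f x * g y * h (-x - y) *
        (ENNReal.ofReal (freqWeight (2 * k + 2 * θ - 2) k x y (-x - y)) *
          (modDecay θ x * modDecay θ (-x - y))) ≤
        C * (l2norm volume f * l2norm volume g * l2norm volume h) := by
    intro f g h hf hg hh
    rw [lintegral_lintegral_swap (by fun_prop), mul_comm (l2norm volume f)]
    refine le_trans (le_of_eq ?_) (hC g f h hg hf hh)
    refine lintegral_congr fun y => lintegral_congr fun x => ?_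
    rw [freqWeight_swap12, show -x - y = -y - x by abel]
    ring
  have hreflect : ∫⁻ x, ∫⁻ y, f x * g y * h (-x - y) *
        (ENNReal.ofReal (freqWeight (2 * k + 2 * θ - 2) k x y (-x - y)) *
          (modDecay θ x * modDecay θ y)) ≤
        C * (l2norm volume f * l2norm volume g * l2norm volume h) := by
    rw [mul_right_comm (l2norm volume f)]
    refine le_trans (le_of_eq ?_) (hswap f h g hf hh hg)
    refine lintegral_congr fun x => ?_
    rw [← lintegral_sub_left_eq_self _ (-x)]
    refine lintegral_congr fun y => ?_
    rw [sub_sub_cancel, freqWeight_swap23]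
    ring
  have hE : ∀ x, f x * (ENNReal.ofReal (bourgainWeight (-k) (θ - 1) x) * ∫⁻ y, F y * G (-x - y)) =
      ∫⁻ y, f x * ENNReal.ofReal (bourgainWeight (-k) (θ - 1) x) * (F y * G (-x - y)) := by
    intro x
    rw [lintegral_const_mul _ (by fun_prop), mul_assoc]
  rw [lintegral_congr hE]
  refine (lintegral_mono fun x => lintegral_mono fun y => hpt x y).trans ?_
  simp only [lintegral_const_mul' _ _ (ENNReal.ofNat_ne_top (n := 6))]
  have hsplit : ∀ x, ∫⁻ y, (f x * g y * h (-x - y) * (ENNReal.ofReal (freqWeight (2 * k + 2 * θ - 2)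
          k x y (-x - y)) * (modDecay θ y * modDecay θ (-x - y))) +
        f x * g y * h (-x - y) * (ENNReal.ofReal (freqWeight (2 * k + 2 * θ - 2) k x y (-x - y)) *
          (modDecay θ x * modDecay θ (-x - y))) +
        f x * g y * h (-x - y) * (ENNReal.ofReal (freqWeight (2 * k + 2 * θ - 2) k x y (-x - y)) *
          (modDecay θ x * modDecay θ y))) =
      (∫⁻ y, f x * g y * h (-x - y) * (ENNReal.ofReal (freqWeight (2 * k + 2 * θ - 2)
          k x y (-x - y)) * (modDecay θ y * modDecay θ (-x - y)))) +
      (∫⁻ y, f x * g y * h (-x - y) * (ENNReal.ofReal (freqWeight (2 * k + 2 * θ - 2)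
          k x y (-x - y)) * (modDecay θ x * modDecay θ (-x - y)))) +
      (∫⁻ y, f x * g y * h (-x - y) * (ENNReal.ofReal (freqWeight (2 * k + 2 * θ - 2)
          k x y (-x - y)) * (modDecay θ x * modDecay θ y))) := fun x => by
    rw [lintegral_add_left (by fun_prop), lintegral_add_left (by fun_prop)]
  rw [lintegral_congr hsplit, lintegral_add_left (by
      refine Measurable.add ?_ ?_ <;> refine Measurable.lintegral_prod_right ?_ <;> fun_prop),
    lintegral_add_left (by refine Measurable.lintegral_prod_right ?_; fun_prop)]
  refine (mul_le_mul_right (add_le_add (add_le_add (hC f g h hf hg hh) (hswap f g h hf hg hh))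
    hreflect) _).trans (le_of_eq ?_)
  push_cast
  ring

end BilinearEstimate

/-! ### The space-time Fourier transform of Schwartz functions -/

section Fourier

open FourierTransform

variable {n : ℕ}

/-- Space-time with the Euclidean norm. -/
abbrev EuclideanSpaceTime (n : ℕ) : Type := WithLp 2 (EuclideanSpace ℝ (Fin n) × ℝ)

/-- The identification of the two normings of space-time. -/
noncomputable def spaceTimeEquiv (n : ℕ) : EuclideanSpaceTime n ≃L[ℝ] SpaceTime n :=
  WithLp.prodContinuousLinearEquiv 2 ℝ (EuclideanSpace ℝ (Fin n)) ℝ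

/-- The change of frequency variables `ζ ↦ ζ / 2π` between the normalization
`e^{-i⟨z, ζ⟩}` of the Fourier transform and the normalization `e^{-2πi⟨z, ζ⟩}`. -/
noncomputable def frequencyEquiv (n : ℕ) : SpaceTime n ≃L[ℝ] EuclideanSpaceTime n :=
  (ContinuousLinearEquiv.smulLeft (Units.mk0 ((2 * Real.pi)⁻¹ : ℝ) (by positivity))).trans
    (spaceTimeEquiv n).symm

theorem frequencyEquiv_apply (ζ : SpaceTime n) :
    frequencyEquiv n ζ = WithLp.toLp 2 ((2 * Real.pi)⁻¹ • ζ) := rfl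

/-- The space-time Fourier transform on Schwartz functions. -/
noncomputable def schwartzFourier : 𝓢(SpaceTime n, ℂ) →L[ℂ] 𝓢(SpaceTime n, ℂ) :=
  (SchwartzMap.compCLMOfContinuousLinearEquiv ℂ (frequencyEquiv n)).comp
    ((fourierCLM ℂ 𝓢(EuclideanSpaceTime n, ℂ)).comp
      (SchwartzMap.compCLMOfContinuousLinearEquiv ℂ (spaceTimeEquiv n)))

/-- The inverse of the space-time Fourier transform on Schwartz functions. -/
noncomputable def schwartzFourierInv : 𝓢(SpaceTime n, ℂ) →L[ℂ] 𝓢(SpaceTime n, ℂ) :=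
  (SchwartzMap.compCLMOfContinuousLinearEquiv ℂ (spaceTimeEquiv n).symm).comp
    ((fourierInvCLM ℂ 𝓢(EuclideanSpaceTime n, ℂ)).comp
      (SchwartzMap.compCLMOfContinuousLinearEquiv ℂ (frequencyEquiv n).symm))

theorem schwartzFourier_inv (φ : 𝓢(SpaceTime n, ℂ)) :
    schwartzFourier (schwartzFourierInv φ) = φ := by
  have h : SchwartzMap.compCLMOfContinuousLinearEquiv ℂ (spaceTimeEquiv n)
      (SchwartzMap.compCLMOfContinuousLinearEquiv ℂ (spaceTimeEquiv n).symm
        (𝓕⁻ (SchwartzMap.compCLMOfContinuousLinearEquiv ℂ (frequencyEquiv n).symm φ))) =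
      𝓕⁻ (SchwartzMap.compCLMOfContinuousLinearEquiv ℂ (frequencyEquiv n).symm φ) := by
    ext z
    simp
  ext ζ
  simp only [schwartzFourier, schwartzFourierInv, ContinuousLinearMap.comp_apply,
    fourierCLM_apply, fourierInvCLM_apply]
  rw [h, fourier_fourierInv_eq]
  simp

theorem schwartzFourierInv_fourier (φ : 𝓢(SpaceTime n, ℂ)) :
    schwartzFourierInv (schwartzFourier φ) = φ := by
  have h : SchwartzMap.compCLMOfContinuousLinearEquiv ℂ (frequencyEquiv n).symm
      (SchwartzMap.compCLMOfContinuousLinearEquiv ℂ (frequencyEquiv n)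
        (𝓕 (SchwartzMap.compCLMOfContinuousLinearEquiv ℂ (spaceTimeEquiv n) φ))) =
      𝓕 (SchwartzMap.compCLMOfContinuousLinearEquiv ℂ (spaceTimeEquiv n) φ) := by
    ext z
    simp
  ext ζ
  simp only [schwartzFourier, schwartzFourierInv, ContinuousLinearMap.comp_apply,
    fourierCLM_apply, fourierInvCLM_apply]
  rw [h, fourierInv_fourier_eq]
  simp

theorem integral_euclideanSpaceTime (F : SpaceTime n → ℂ) :
    ∫ v : EuclideanSpaceTime n, F (spaceTimeEquiv n v) = ∫ z, F z :=
  (WithLp.volume_preserving_ofLp (EuclideanSpace ℝ (Fin n)) ℝ).integral_comp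
    (MeasurableEquiv.toLp 2 (EuclideanSpace ℝ (Fin n) × ℝ)).symm.measurableEmbedding F

theorem schwartzFourier_apply (u : 𝓢(SpaceTime n, ℂ)) (ζ : SpaceTime n) :
    schwartzFourier u ζ = spacetimeFourier u ζ := by
  have h1 : schwartzFourier u ζ = 𝓕 (fun v : EuclideanSpaceTime n => u (spaceTimeEquiv n v))
    (frequencyEquiv n ζ) := rfl
  rw [h1, Real.fourier_eq', spacetimeFourier, ← integral_euclideanSpaceTime]
  refine integral_congr_ae (ae_of_all _ fun v => ?_)
  simp only [smul_eq_mul]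
  congr 2
  have h2 : inner ℝ v (frequencyEquiv n ζ) =
      (2 * Real.pi)⁻¹ * (inner ℝ (spaceTimeEquiv n v).1 ζ.1 + (spaceTimeEquiv n v).2 * ζ.2) := by
    rw [frequencyEquiv_apply, WithLp.prod_inner_apply]
    have h3 : (spaceTimeEquiv n v) = v.ofLp := rfl
    simp only [h3, Prod.smul_fst, Prod.smul_snd, inner_smul_right, smul_eq_mul,
      RCLike.inner_apply, conj_trivial]
    ring
  rw [h2]
  push_cast
  field_simp

/-- The pairing `(z, ζ) ↦ (x · ξ + t τ) / 2π`. -/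
noncomputable def spaceTimePairing (n : ℕ) : SpaceTime n →ₗ[ℝ] SpaceTime n →ₗ[ℝ] ℝ :=
  LinearMap.mk₂ ℝ (fun z ζ => (2 * Real.pi)⁻¹ * (inner ℝ z.1 ζ.1 + z.2 * ζ.2))
    (fun z z' ζ => by simp only [Prod.fst_add, Prod.snd_add, inner_add_left]; ring)
    (fun c z ζ => by
      simp only [Prod.smul_fst, Prod.smul_snd, real_inner_smul_left, smul_eq_mul]; ring)
    (fun z ζ ζ' => by simp only [Prod.fst_add, Prod.snd_add, inner_add_right]; ring)
    (fun c z ζ => by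
      simp only [Prod.smul_fst, Prod.smul_snd, real_inner_smul_right, smul_eq_mul]; ring)

theorem spacetimeFourier_eq_fourierIntegral (w : SpaceTime n → ℂ) :
    spacetimeFourier w = VectorFourier.fourierIntegral Real.fourierChar volume
      (spaceTimePairing n) w := by
  ext ζ
  simp only [spacetimeFourier, VectorFourier.fourierIntegral, Circle.smul_def,
    Real.fourierChar_apply, smul_eq_mul]
  refine integral_congr_ae (ae_of_all _ fun z => ?_)
  simp only [spaceTimePairing, LinearMap.mk₂_apply]
  congr 2
  push_cast
  field_simp

/-- The Fourier transform is symmetric: `∫ û v = ∫ u v̂`. -/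
theorem integral_spacetimeFourier_mul (u v : 𝓢(SpaceTime n, ℂ)) :
    ∫ ζ, spacetimeFourier u ζ * v ζ = ∫ z, u z * spacetimeFourier v z := by
  have hflip : (spaceTimePairing n).flip = spaceTimePairing n := by
    ext z ζ <;> simp [spaceTimePairing, mul_comm, real_inner_comm]
  have hcont : Continuous fun p : SpaceTime n × SpaceTime n => spaceTimePairing n p.1 p.2 := by
    simp only [spaceTimePairing, LinearMap.mk₂_apply]
    fun_prop
  have := VectorFourier.integral_fourierIntegral_smul_eq_flip (μ := volume) (ν := volume)
    (L := spaceTimePairing n) Real.continuous_fourierChar hcont u.integrable v.integrable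
  rw [hflip, ← spacetimeFourier_eq_fourierIntegral, ← spacetimeFourier_eq_fourierIntegral] at this
  exact this

/-- The convolution `(2π)^{-(n+1)} ∫ f̄(η) ḡ(-ζ-η) dη`, which is the Fourier transform of `ū v̄` if
`f = û` and `g = v̂`. -/
noncomputable def conjConvolution (f g : SpaceTime n → ℂ) (ζ : SpaceTime n) : ℂ :=
  ((2 * Real.pi)⁻¹ ^ (n + 1) : ℝ) * ∫ η, starRingEnd ℂ (f η) * starRingEnd ℂ (g (-ζ - η))

theorem fourier_mul_eq_integral {V : Type*} [NormedAddCommGroup V] [InnerProductSpace ℝ V]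
    [FiniteDimensional ℝ V] [MeasurableSpace V] [BorelSpace V] (f g : 𝓢(V, ℂ)) (x : V) :
    𝓕 (SchwartzMap.pairing (ContinuousLinearMap.mul ℂ ℂ) f g) x = ∫ y, 𝓕 f y * 𝓕 g (x - y) := by
  have h1 : SchwartzMap.convolution (ContinuousLinearMap.mul ℂ ℂ) (𝓕⁻ f) (𝓕⁻ g) =
      𝓕⁻ (SchwartzMap.pairing (ContinuousLinearMap.mul ℂ ℂ) f g) := by
    have := SchwartzMap.fourier_convolution (ContinuousLinearMap.mul ℂ ℂ) (𝓕⁻ f) (𝓕⁻ g)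
    rw [fourier_fourierInv_eq, fourier_fourierInv_eq] at this
    rw [← this, fourierInv_fourier_eq]
  have h2 : ∀ (h : 𝓢(V, ℂ)) (y : V), 𝓕 h y = 𝓕⁻ h (-y) := by
    intro h y
    rw [SchwartzMap.fourier_coe, SchwartzMap.fourierInv_coe, Real.fourierInv_eq_fourier_neg,
      neg_neg]
  rw [h2, ← h1, SchwartzMap.convolution_apply, ← integral_neg_eq_self]
  refine integral_congr_ae (ae_of_all _ fun y => ?_)
  simp only [ContinuousLinearMap.mul_apply', h2, neg_neg]
  congr 2
  abel

theorem spacetimeFourier_conj (w : SpaceTime n → ℂ) (ζ : SpaceTime n) :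
    spacetimeFourier (fun z => starRingEnd ℂ (w z)) ζ =
      starRingEnd ℂ (spacetimeFourier w (-ζ)) := by
  unfold spacetimeFourier
  rw [← integral_conj]
  refine integral_congr_ae (ae_of_all _ fun z => ?_)
  simp only [map_mul, ← Complex.exp_conj]
  congr 2
  simp [Complex.conj_ofReal]
  ring

theorem spacetimeFourier_mul (u v : 𝓢(SpaceTime n, ℂ)) (ζ : SpaceTime n) :
    spacetimeFourier (fun z => u z * v z) ζ = ((2 * Real.pi)⁻¹ ^ (n + 1) : ℝ) *
      ∫ η, spacetimeFourier u η * spacetimeFourier v (ζ - η) := by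
  set U := SchwartzMap.compCLMOfContinuousLinearEquiv ℂ (spaceTimeEquiv n) u with hU
  set V := SchwartzMap.compCLMOfContinuousLinearEquiv ℂ (spaceTimeEquiv n) v with hV
  have hprod : spacetimeFourier (fun z => u z * v z) ζ =
      𝓕 (SchwartzMap.pairing (ContinuousLinearMap.mul ℂ ℂ) U V) (frequencyEquiv n ζ) :=
    (schwartzFourier_apply (SchwartzMap.pairing (ContinuousLinearMap.mul ℂ ℂ) u v) ζ).symm
  rw [hprod, fourier_mul_eq_integral]
  have hF : ∀ (w : 𝓢(SpaceTime n, ℂ)) (η : SpaceTime n), spacetimeFourier w η =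
      𝓕 (SchwartzMap.compCLMOfContinuousLinearEquiv ℂ (spaceTimeEquiv n) w)
        (frequencyEquiv n η) := fun w η => (schwartzFourier_apply w η).symm
  simp only [hF, map_sub, ← hU, ← hV]
  -- the change of variables `y = η / 2π`
  have hscale := Measure.integral_comp_smul (volume : Measure (SpaceTime n))
    (fun η => 𝓕 U ((spaceTimeEquiv n).symm η) *
      𝓕 V (frequencyEquiv n ζ - (spaceTimeEquiv n).symm η)) (2 * Real.pi)⁻¹
  have hsym : ∀ η : SpaceTime n, (spaceTimeEquiv n).symm ((2 * Real.pi)⁻¹ • η) =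
      frequencyEquiv n η := fun η => rfl
  simp only [hsym] at hscale
  rw [hscale]
  have hfin : Module.finrank ℝ (SpaceTime n) = n + 1 := by simp
  have hpos : (0 : ℝ) < (2 * Real.pi)⁻¹ ^ (n + 1) := by positivity
  rw [hfin, abs_of_pos (inv_pos.2 hpos), Complex.real_smul, ← mul_assoc, ← Complex.ofReal_mul,
    mul_inv_cancel₀ hpos.ne', Complex.ofReal_one, one_mul, ← integral_euclideanSpaceTime]
  simp

theorem spacetimeFourier_conj_mul_conj (u v : 𝓢(SpaceTime n, ℂ)) (ζ : SpaceTime n) :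
    spacetimeFourier (fun z => starRingEnd ℂ (u z) * starRingEnd ℂ (v z)) ζ =
      conjConvolution (spacetimeFourier u) (spacetimeFourier v) ζ := by
  have hc : ∀ (w : 𝓢(SpaceTime n, ℂ)),
      spacetimeFourier (SchwartzMap.postcompCLM (Complex.conjCLE : ℂ →L[ℝ] ℂ) w) =
        fun η => starRingEnd ℂ (spacetimeFourier w (-η)) := fun w =>
    funext fun η => spacetimeFourier_conj w η
  have := spacetimeFourier_mul (SchwartzMap.postcompCLM (Complex.conjCLE : ℂ →L[ℝ] ℂ) u)
    (SchwartzMap.postcompCLM (Complex.conjCLE : ℂ →L[ℝ] ℂ) v) ζ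
  rw [hc, hc, ← integral_neg_eq_self] at this
  refine Eq.trans this ?_
  unfold conjConvolution
  simp only [neg_neg, sub_neg_eq_add, neg_add']

end Fourier

/-! ### Weighted norms and Fourier transforms of tempered distributions -/

section Distributions

variable {n : ℕ}

theorem weightedL2Norm_eq_eLpNorm (s θ : ℝ) (f : SpaceTime n → ℂ) :
    weightedL2Norm s θ f = eLpNorm (fun ζ => ((bourgainWeight s θ ζ : ℝ) : ℂ) * f ζ) 2 volume :=
  rfl

theorem enorm_complex_ofReal (r : ℝ) : ‖(r : ℂ)‖ₑ = ‖r‖ₑ :=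
  enorm_eq_iff_norm_eq.2 (Complex.norm_real r)

theorem weightedL2Norm_eq_l2norm (s θ : ℝ) (f : SpaceTime n → ℂ) :
    weightedL2Norm s θ f =
      l2norm volume fun ζ => ENNReal.ofReal (bourgainWeight s θ ζ) * ‖f ζ‖ₑ := by
  rw [weightedL2Norm_eq_eLpNorm, eLpNorm_eq_lintegral_rpow_enorm_toReal two_ne_zero
    ENNReal.ofNat_ne_top, l2norm]
  simp only [ENNReal.toReal_ofNat, ENNReal.rpow_ofNat, enorm_mul, enorm_complex_ofReal,
    Real.enorm_of_nonneg (bourgainWeight_pos _ _ _).le]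

theorem aestronglyMeasurable_weight_mul {s θ : ℝ} {f : SpaceTime n → ℂ}
    (hf : AEStronglyMeasurable f volume) :
    AEStronglyMeasurable (fun ζ => ((bourgainWeight s θ ζ : ℝ) : ℂ) * f ζ) volume :=
  (Complex.continuous_ofReal.comp (continuous_bourgainWeight s θ)).aestronglyMeasurable.mul hf

theorem weightedL2Norm_congr_ae {s θ : ℝ} {f g : SpaceTime n → ℂ} (h : f =ᵐ[volume] g) :
    weightedL2Norm s θ f = weightedL2Norm s θ g := by
  refine eLpNorm_congr_ae ?_
  filter_upwards [h] with ζ hζ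
  rw [hζ]

theorem weightedL2Norm_add_le {s θ : ℝ} {f g : SpaceTime n → ℂ}
    (hf : AEStronglyMeasurable f volume) (hg : AEStronglyMeasurable g volume) :
    weightedL2Norm s θ (fun ζ => f ζ + g ζ) ≤ weightedL2Norm s θ f + weightedL2Norm s θ g := by
  simp only [weightedL2Norm_eq_eLpNorm, mul_add]
  exact eLpNorm_add_le (aestronglyMeasurable_weight_mul hf) (aestronglyMeasurable_weight_mul hg)
    (by norm_num)

theorem weightedL2Norm_neg {s θ : ℝ} (f : SpaceTime n → ℂ) :
    weightedL2Norm s θ (fun ζ => -f ζ) = weightedL2Norm s θ f := by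
  simp only [weightedL2Norm_eq_l2norm, enorm_neg]

theorem quasiMeasurePreserving_neg_sub (ζ : SpaceTime n) :
    Measure.QuasiMeasurePreserving (fun η : SpaceTime n => -ζ - η) volume volume :=
  (Measure.measurePreserving_sub_left volume (-ζ)).quasiMeasurePreserving

theorem enorm_conjConvolution_le (f g : SpaceTime n → ℂ) (ζ : SpaceTime n) :
    ‖conjConvolution f g ζ‖ₑ ≤ ∫⁻ η, ‖f η‖ₑ * ‖g (-ζ - η)‖ₑ := by
  have hc : ‖(((2 * Real.pi)⁻¹ ^ (n + 1) : ℝ) : ℂ)‖ₑ ≤ 1 := by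
    rw [enorm_complex_ofReal, Real.enorm_of_nonneg (by positivity), ENNReal.ofReal_le_one]
    refine pow_le_one₀ (by positivity) (inv_le_one_of_one_le₀ ?_)
    linarith [Real.two_le_pi]
  rw [conjConvolution, enorm_mul, ← one_mul (∫⁻ η, ‖f η‖ₑ * ‖g (-ζ - η)‖ₑ)]
  refine mul_le_mul' hc ((enorm_integral_le_lintegral_enorm _).trans (le_of_eq ?_))
  simp only [enorm_mul, RCLike.enorm_conj]

theorem lintegral_enorm_mk {f g : SpaceTime n → ℂ} (hf : AEStronglyMeasurable f volume)
    (hg : AEStronglyMeasurable g volume) (ζ : SpaceTime n) :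
    ∫⁻ η, ‖f η‖ₑ * ‖g (-ζ - η)‖ₑ = ∫⁻ η, ‖hf.mk f η‖ₑ * ‖hg.mk g (-ζ - η)‖ₑ := by
  refine lintegral_congr_ae ?_
  filter_upwards [hf.ae_eq_mk, (quasiMeasurePreserving_neg_sub ζ).ae_eq_comp hg.ae_eq_mk]
    with η h1 h2
  simp only [Function.comp_apply] at h2
  rw [h1, h2]

theorem aestronglyMeasurable_conjConvolution {f g : SpaceTime n → ℂ}
    (hf : AEStronglyMeasurable f volume) (hg : AEStronglyMeasurable g volume) :
    AEStronglyMeasurable (conjConvolution f g) volume := by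
  have h1 : conjConvolution f g = conjConvolution (hf.mk f) (hg.mk g) := by
    ext ζ
    unfold conjConvolution
    congr 1
    refine integral_congr_ae ?_
    filter_upwards [hf.ae_eq_mk, (quasiMeasurePreserving_neg_sub ζ).ae_eq_comp hg.ae_eq_mk]
      with η h1 h2
    simp only [Function.comp_apply] at h2
    rw [h1, h2]
  have hfm := hf.stronglyMeasurable_mk.measurable
  have hgm := hg.stronglyMeasurable_mk.measurable
  rw [h1]
  unfold conjConvolution
  refine AEStronglyMeasurable.const_mul ?_ _
  refine (StronglyMeasurable.integral_prod_right (f := fun ζ η : SpaceTime n =>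
    starRingEnd ℂ (hf.mk f η) * starRingEnd ℂ (hg.mk g (-ζ - η))) ?_).aestronglyMeasurable
  refine Measurable.stronglyMeasurable ?_
  have hcm : Measurable (starRingEnd ℂ) := Complex.continuous_conj.measurable
  unfold Function.uncurry
  fun_prop

/-- The bilinear estimate holds between weighted `L²` norms with the exponents `s` and `θ`. -/
def BilinearBound (n : ℕ) (s θ : ℝ) (C : ℝ≥0) : Prop :=
  ∀ F G : SpaceTime n → ℝ≥0∞, Measurable F → Measurable G →
    l2norm volume (fun ζ => ENNReal.ofReal (bourgainWeight s (θ - 1) ζ) *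
      ∫⁻ η, F η * G (-ζ - η)) ≤
    C * (l2norm volume (fun ζ => ENNReal.ofReal (bourgainWeight s θ ζ) * F ζ) *
      l2norm volume (fun ζ => ENNReal.ofReal (bourgainWeight s θ ζ) * G ζ))

theorem BilinearBound.l2norm_lintegral_le {s θ : ℝ} {C : ℝ≥0} (hC : BilinearBound n s θ C)
    {f g : SpaceTime n → ℂ} (hf : AEStronglyMeasurable f volume)
    (hg : AEStronglyMeasurable g volume) :
    l2norm volume (fun ζ => ENNReal.ofReal (bourgainWeight s (θ - 1) ζ) *
      ∫⁻ η, ‖f η‖ₑ * ‖g (-ζ - η)‖ₑ) ≤ C * (weightedL2Norm s θ f * weightedL2Norm s θ g) := by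
  simp only [lintegral_enorm_mk hf hg]
  rw [weightedL2Norm_congr_ae hf.ae_eq_mk, weightedL2Norm_congr_ae hg.ae_eq_mk,
    weightedL2Norm_eq_l2norm, weightedL2Norm_eq_l2norm]
  exact hC _ _ hf.stronglyMeasurable_mk.measurable.enorm hg.stronglyMeasurable_mk.measurable.enorm

theorem BilinearBound.weightedL2Norm_conjConvolution_le {s θ : ℝ} {C : ℝ≥0}
    (hC : BilinearBound n s θ C) {f g : SpaceTime n → ℂ} (hf : AEStronglyMeasurable f volume)
    (hg : AEStronglyMeasurable g volume) :
    weightedL2Norm s (θ - 1) (conjConvolution f g) ≤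
      C * (weightedL2Norm s θ f * weightedL2Norm s θ g) := by
  refine le_trans ?_ (hC.l2norm_lintegral_le hf hg)
  rw [weightedL2Norm_eq_l2norm]
  refine l2norm_mono fun ζ => ?_
  gcongr
  exact enorm_conjConvolution_le f g ζ

/-- By the bilinear estimate, the integral that defines the convolution converges at almost
every point. -/
theorem BilinearBound.ae_integrable {s θ : ℝ} {C : ℝ≥0} (hC : BilinearBound n s θ C)
    {f g : SpaceTime n → ℂ} (hf : AEStronglyMeasurable f volume)
    (hg : AEStronglyMeasurable g volume) (hf' : weightedL2Norm s θ f < ∞)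
    (hg' : weightedL2Norm s θ g < ∞) :
    ∀ᵐ ζ, Integrable fun η => starRingEnd ℂ (f η) * starRingEnd ℂ (g (-ζ - η)) := by
  have h1 := hC.l2norm_lintegral_le hf hg
  have hfm := hf.stronglyMeasurable_mk.measurable
  have hgm := hg.stronglyMeasurable_mk.measurable
  have hfin : ∫⁻ ζ, (ENNReal.ofReal (bourgainWeight s (θ - 1) ζ) *
      ∫⁻ η, ‖f η‖ₑ * ‖g (-ζ - η)‖ₑ) ^ 2 ≠ ∞ := by
    rw [← l2norm_sq]
    have : l2norm volume (fun ζ => ENNReal.ofReal (bourgainWeight s (θ - 1) ζ) *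
      ∫⁻ η, ‖f η‖ₑ * ‖g (-ζ - η)‖ₑ) ≠ ∞ := ne_top_of_le_ne_top (by finiteness) h1
    finiteness
  have hmeas : Measurable fun ζ => (ENNReal.ofReal (bourgainWeight s (θ - 1) ζ) *
      ∫⁻ η, ‖f η‖ₑ * ‖g (-ζ - η)‖ₑ) ^ 2 := by
    simp only [lintegral_enorm_mk hf hg]
    refine Measurable.pow_const (Measurable.mul (by fun_prop)
      (Measurable.lintegral_prod_right ?_)) 2
    fun_prop
  filter_upwards [ae_lt_top hmeas hfin] with ζ hζ
  refine ⟨?_, ?_⟩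
  · exact (Complex.continuous_conj.comp_aestronglyMeasurable hf).mul
      (Complex.continuous_conj.comp_aestronglyMeasurable
        (hg.comp_quasiMeasurePreserving (quasiMeasurePreserving_neg_sub ζ)))
  · rw [hasFiniteIntegral_iff_enorm]
    simp only [enorm_mul, RCLike.enorm_conj]
    -- the weight is positive, so an infinite integral would make the product infinite
    by_contra hcon
    rw [not_lt_top_iff] at hcon
    rw [hcon, ENNReal.mul_top (by simpa using bourgainWeight_pos _ _ _)] at hζ
    simp at hζ

theorem conjConvolution_sub_conjConvolution {f f' g g' : SpaceTime n → ℂ} {ζ : SpaceTime n}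
    (h1 : Integrable fun η => starRingEnd ℂ (f η) * starRingEnd ℂ (g (-ζ - η)))
    (h2 : Integrable fun η => starRingEnd ℂ (f' η) * starRingEnd ℂ (g (-ζ - η)))
    (h3 : Integrable fun η => starRingEnd ℂ (f' η) * starRingEnd ℂ (g' (-ζ - η))) :
    conjConvolution f g ζ - conjConvolution f' g' ζ =
      conjConvolution (fun η => f η - f' η) g ζ + conjConvolution f' (fun η => g η - g' η) ζ := by
  unfold conjConvolution
  rw [← mul_sub, ← mul_add]
  congr 1
  have e1 : ∀ η, starRingEnd ℂ (f η - f' η) * starRingEnd ℂ (g (-ζ - η)) =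
      starRingEnd ℂ (f η) * starRingEnd ℂ (g (-ζ - η)) -
        starRingEnd ℂ (f' η) * starRingEnd ℂ (g (-ζ - η)) := fun η => by rw [map_sub, sub_mul]
  have e2 : ∀ η, starRingEnd ℂ (f' η) * starRingEnd ℂ (g (-ζ - η) - g' (-ζ - η)) =
      starRingEnd ℂ (f' η) * starRingEnd ℂ (g (-ζ - η)) -
        starRingEnd ℂ (f' η) * starRingEnd ℂ (g' (-ζ - η)) := fun η => by rw [map_sub, mul_sub]
  simp only [e1, e2]
  rw [integral_sub h1 h2, integral_sub h2 h3]
  ring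

/-- Integrability against a Schwartz function that is `1` on a given compact set. -/
theorem HasFourierTransform.locallyIntegrable {T : 𝓢'(SpaceTime n, ℂ)} {f : SpaceTime n → ℂ}
    (h : HasFourierTransform T f) : LocallyIntegrable f volume := by
  rw [locallyIntegrable_iff]
  intro K hK
  obtain ⟨R, hR, hKR⟩ := hK.isBounded.subset_closedBall_lt 0 0
  let b : ContDiffBump (0 : SpaceTime n) := ⟨R, R + 1, hR, by linarith⟩
  have hbs : HasCompactSupport fun z : SpaceTime n => ((b z : ℝ) : ℂ) :=
    b.hasCompactSupport.comp_left Complex.ofReal_zero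
  have hbc : ContDiff ℝ ((⊤ : ℕ∞) : WithTop ℕ∞) fun z : SpaceTime n => ((b z : ℝ) : ℂ) :=
    Complex.ofRealCLM.contDiff.comp b.contDiff
  have hint := (h.1 (hbs.toSchwartzMap hbc)).integrableOn (s := K)
  refine hint.congr_fun (fun z hz => ?_) hK.measurableSet
  have : b z = 1 := b.one_of_mem_closedBall (hKR hz)
  simp [this]

theorem HasFourierTransform.aestronglyMeasurable {T : 𝓢'(SpaceTime n, ℂ)} {f : SpaceTime n → ℂ}
    (h : HasFourierTransform T f) : AEStronglyMeasurable f volume :=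
  h.locallyIntegrable.aestronglyMeasurable

theorem HasFourierTransform.apply_eq {T : 𝓢'(SpaceTime n, ℂ)} {f : SpaceTime n → ℂ}
    (h : HasFourierTransform T f) (ψ : 𝓢(SpaceTime n, ℂ)) :
    T ψ = ∫ ζ, f ζ * schwartzFourierInv ψ ζ :=
  h.2 _ _ fun ζ => by rw [← schwartzFourier_apply, schwartzFourier_inv]

theorem HasFourierTransform.ae_eq {T : 𝓢'(SpaceTime n, ℂ)} {f g : SpaceTime n → ℂ}
    (hf : HasFourierTransform T f) (hg : HasFourierTransform T g) : f =ᵐ[volume] g := by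
  refine ae_eq_of_integral_contDiff_smul_eq hf.locallyIntegrable hg.locallyIntegrable
    fun b hb hbs => ?_
  have hbs' : HasCompactSupport fun z : SpaceTime n => ((b z : ℝ) : ℂ) :=
    hbs.comp_left Complex.ofReal_zero
  have hbc : ContDiff ℝ ((⊤ : ℕ∞) : WithTop ℕ∞) fun z : SpaceTime n => ((b z : ℝ) : ℂ) :=
    Complex.ofRealCLM.contDiff.comp hb
  have h1 := hf.2 (hbs'.toSchwartzMap hbc) _ (schwartzFourier_apply _)
  have h2 := hg.2 (hbs'.toSchwartzMap hbc) _ (schwartzFourier_apply _)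
  rw [h1] at h2
  simpa [mul_comm] using h2

/-- The infimum in the norm of a distribution is attained at every representative, because the
representatives agree almost everywhere. -/
theorem HasFourierTransform.distBourgainNorm_eq {T : 𝓢'(SpaceTime n, ℂ)} {f : SpaceTime n → ℂ}
    (h : HasFourierTransform T f) (s θ : ℝ) :
    distBourgainNorm s θ T = weightedL2Norm s θ f := by
  refine le_antisymm (iInf₂_le f h) (le_iInf₂ fun g hg => ?_)
  rw [weightedL2Norm_congr_ae (h.ae_eq hg)]

theorem exists_hasFourierTransform {T : 𝓢'(SpaceTime n, ℂ)} {s θ : ℝ}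
    (h : distBourgainNorm s θ T < ∞) : ∃ f, HasFourierTransform T f := by
  by_contra! hcon
  refine h.ne ?_
  simp [distBourgainNorm, hcon]

theorem HasFourierTransform.add {T S : 𝓢'(SpaceTime n, ℂ)} {f g : SpaceTime n → ℂ}
    (hf : HasFourierTransform T f) (hg : HasFourierTransform S g) :
    HasFourierTransform (T + S) fun ζ => f ζ + g ζ := by
  refine ⟨fun φ => ?_, fun φ ψ h => ?_⟩
  · simp only [add_mul]
    exact (hf.1 φ).add (hg.1 φ)
  · simp only [add_mul]
    rw [integral_add (hf.1 φ) (hg.1 φ), ← hf.2 φ ψ h, ← hg.2 φ ψ h]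
    rfl

theorem HasFourierTransform.neg {T : 𝓢'(SpaceTime n, ℂ)} {f : SpaceTime n → ℂ}
    (hf : HasFourierTransform T f) : HasFourierTransform (-T) fun ζ => -f ζ := by
  refine ⟨fun φ => ?_, fun φ ψ h => ?_⟩
  · simp only [neg_mul]
    exact (hf.1 φ).neg
  · simp only [neg_mul]
    rw [integral_neg, ← hf.2 φ ψ h]
    rfl

theorem HasFourierTransform.sub {T S : 𝓢'(SpaceTime n, ℂ)} {f g : SpaceTime n → ℂ}
    (hf : HasFourierTransform T f) (hg : HasFourierTransform S g) :
    HasFourierTransform (T - S) fun ζ => f ζ - g ζ := by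
  simp only [sub_eq_add_neg]
  exact hf.add hg.neg

theorem hasFourierTransform_toDist (w : 𝓢(SpaceTime n, ℂ)) :
    HasFourierTransform (toDist w) (spacetimeFourier w) := by
  refine ⟨fun φ => ?_, fun φ ψ h => ?_⟩
  · have := (SchwartzMap.pairing (ContinuousLinearMap.mul ℂ ℂ) (schwartzFourier w) φ).integrable
      (μ := volume)
    refine this.congr (ae_of_all _ fun ζ => ?_)
    simp [schwartzFourier_apply]
  · rw [toDist_apply, integral_spacetimeFourier_mul]
    refine integral_congr_ae (ae_of_all _ fun z => ?_)
    simp only [h, mul_comm]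

theorem distBourgainNorm_add_le {s θ : ℝ} (T S : 𝓢'(SpaceTime n, ℂ)) :
    distBourgainNorm s θ (T + S) ≤ distBourgainNorm s θ T + distBourgainNorm s θ S := by
  by_cases hT : distBourgainNorm s θ T < ∞
  · by_cases hS : distBourgainNorm s θ S < ∞
    · obtain ⟨f, hf⟩ := exists_hasFourierTransform hT
      obtain ⟨g, hg⟩ := exists_hasFourierTransform hS
      rw [hf.distBourgainNorm_eq, hg.distBourgainNorm_eq, (hf.add hg).distBourgainNorm_eq]
      exact weightedL2Norm_add_le hf.aestronglyMeasurable hg.aestronglyMeasurable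
    · simp [not_lt_top_iff.1 hS]
  · simp [not_lt_top_iff.1 hT]

theorem distBourgainNorm_neg_le {s θ : ℝ} (T : 𝓢'(SpaceTime n, ℂ)) :
    distBourgainNorm s θ (-T) ≤ distBourgainNorm s θ T := by
  by_cases hT : distBourgainNorm s θ T < ∞
  · obtain ⟨f, hf⟩ := exists_hasFourierTransform hT
    rw [hf.distBourgainNorm_eq, hf.neg.distBourgainNorm_eq, weightedL2Norm_neg]
  · simp [not_lt_top_iff.1 hT]

theorem ae_eq_zero_of_weightedL2Norm_eq_zero {s θ : ℝ} {f : SpaceTime n → ℂ}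
    (hf : AEStronglyMeasurable f volume) (h : weightedL2Norm s θ f = 0) : f =ᵐ[volume] 0 := by
  rw [weightedL2Norm_eq_eLpNorm, eLpNorm_eq_zero_iff (aestronglyMeasurable_weight_mul hf)
    two_ne_zero] at h
  filter_upwards [h] with ζ hζ
  have := (bourgainWeight_pos s θ ζ).ne'
  simpa [this] using hζ

theorem eq_zero_of_distBourgainNorm_eq_zero {s θ : ℝ} {T : 𝓢'(SpaceTime n, ℂ)}
    (h : distBourgainNorm s θ T = 0) : T = 0 := by
  obtain ⟨f, hf⟩ := exists_hasFourierTransform (s := s) (θ := θ) (T := T) (by simp [h])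
  rw [hf.distBourgainNorm_eq] at h
  have h0 := ae_eq_zero_of_weightedL2Norm_eq_zero hf.aestronglyMeasurable h
  ext ψ
  rw [hf.apply_eq ψ, integral_eq_zero_of_ae]
  · rfl
  · filter_upwards [h0] with ζ hζ
    simp [hζ]

end Distributions

/-! ### Existence and density in the weighted spaces -/

section Completeness

variable {n : ℕ}

theorem bracket_rpow {V : Type*} [NormedAddCommGroup V] (a : V) (s : ℝ) :
    bracket a ^ s = (1 + ‖a‖ ^ 2) ^ (s / 2) := by
  rw [bracket, Real.sqrt_eq_rpow, ← Real.rpow_mul (by positivity)]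
  congr 1
  ring

theorem hasTemperateGrowth_bourgainWeight (s θ : ℝ) :
    Function.HasTemperateGrowth fun ζ : SpaceTime n => ((bourgainWeight s θ ζ : ℝ) : ℂ) := by
  have h1 : Function.HasTemperateGrowth fun ζ : SpaceTime n => ζ.1 :=
    (ContinuousLinearMap.fst ℝ (EuclideanSpace ℝ (Fin n)) ℝ).hasTemperateGrowth
  have h2 : Function.HasTemperateGrowth fun ζ : SpaceTime n => ζ.2 :=
    (ContinuousLinearMap.snd ℝ (EuclideanSpace ℝ (Fin n)) ℝ).hasTemperateGrowth
  have h3 : Function.HasTemperateGrowth fun ζ : SpaceTime n => ζ.2 - ‖ζ.1‖ ^ 2 :=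
    h2.sub ((Function.hasTemperateGrowth_norm_sq (EuclideanSpace ℝ (Fin n))).comp h1)
  have h4 : Function.HasTemperateGrowth fun ζ : SpaceTime n => bracket ζ.1 ^ s := by
    simp only [bracket_rpow]
    exact (Function.hasTemperateGrowth_one_add_norm_sq_rpow (EuclideanSpace ℝ (Fin n))
      (s / 2)).comp h1
  have h5 : Function.HasTemperateGrowth fun ζ : SpaceTime n => bracket (ζ.2 - ‖ζ.1‖ ^ 2) ^ θ := by
    simp only [bracket_rpow]
    exact (Function.hasTemperateGrowth_one_add_norm_sq_rpow ℝ (θ / 2)).comp h3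
  exact Complex.ofRealCLM.hasTemperateGrowth.comp (h4.mul h5)

/-- Multiplication of Schwartz functions by the weight `⟨ξ⟩^s ⟨τ - |ξ|²⟩^θ`. -/
noncomputable def weightCLM (s θ : ℝ) : 𝓢(SpaceTime n, ℂ) →L[ℂ] 𝓢(SpaceTime n, ℂ) :=
  SchwartzMap.smulLeftCLM ℂ fun ζ => ((bourgainWeight s θ ζ : ℝ) : ℂ)

theorem weightCLM_apply (s θ : ℝ) (φ : 𝓢(SpaceTime n, ℂ)) (ζ : SpaceTime n) :
    weightCLM s θ φ ζ = bourgainWeight s θ ζ * φ ζ :=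
  SchwartzMap.smulLeftCLM_apply_apply (hasTemperateGrowth_bourgainWeight s θ) φ ζ

theorem bourgainWeight_mul_neg_mul (s θ : ℝ) (ζ : SpaceTime n) (z : ℂ) :
    (bourgainWeight s θ ζ : ℂ) * (bourgainWeight (-s) (-θ) ζ * z) = z := by
  rw [← mul_assoc, ← Complex.ofReal_mul, bourgainWeight_mul_neg, Complex.ofReal_one, one_mul]

theorem weightedL2Norm_schwartz_lt_top (s θ : ℝ) (φ : 𝓢(SpaceTime n, ℂ)) :
    weightedL2Norm s θ φ < ∞ := by
  have h := (weightCLM s θ φ).eLpNorm_lt_top 2 volume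
  rw [weightedL2Norm_eq_eLpNorm]
  simpa only [← weightCLM_apply] using h

theorem coe_schwartzFourier (u : 𝓢(SpaceTime n, ℂ)) :
    (schwartzFourier u : SpaceTime n → ℂ) = spacetimeFourier u :=
  funext (schwartzFourier_apply u)

theorem weightedL2Norm_spacetimeFourier_lt_top (s θ : ℝ) (u : 𝓢(SpaceTime n, ℂ)) :
    weightedL2Norm s θ (spacetimeFourier u) < ∞ :=
  coe_schwartzFourier u ▸ weightedL2Norm_schwartz_lt_top s θ (schwartzFourier u)

theorem aestronglyMeasurable_spacetimeFourier (u : 𝓢(SpaceTime n, ℂ)) :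
    AEStronglyMeasurable (spacetimeFourier u) volume :=
  coe_schwartzFourier u ▸ (schwartzFourier u).continuous.aestronglyMeasurable

/-- Every measurable function of finite weighted norm is the Fourier transform of a tempered
distribution: the weight times the function is in `L²`, and dividing by the weight preserves
tempered distributions. -/
theorem exists_hasFourierTransform_of_weightedL2Norm_lt_top {s θ : ℝ} {f : SpaceTime n → ℂ}
    (hf : AEStronglyMeasurable f volume) (h : weightedL2Norm s θ f < ∞) :
    ∃ T : 𝓢'(SpaceTime n, ℂ), HasFourierTransform T f := by
  have hL : MemLp (fun ζ => ((bourgainWeight s θ ζ : ℝ) : ℂ) * f ζ) 2 volume :=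
    ⟨aestronglyMeasurable_weight_mul hf, h⟩
  have hmul : ∀ (φ : 𝓢(SpaceTime n, ℂ)) (ζ : SpaceTime n), weightCLM (-s) (-θ) φ ζ *
      (((bourgainWeight s θ ζ : ℝ) : ℂ) * f ζ) = f ζ * φ ζ := by
    intro φ ζ
    rw [weightCLM_apply, mul_comm (_ * φ ζ), mul_right_comm, bourgainWeight_mul_neg_mul, mul_comm]
  refine ⟨PointwiseConvergenceCLM.precomp ℂ ((weightCLM (-s) (-θ)).comp schwartzFourierInv)
    (Lp.toTemperedDistribution hL.toLp), fun φ => ?_, fun φ ψ hψ => ?_⟩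
  · have hφ := (weightCLM (-s) (-θ) φ).memLp 2 volume
    refine (hφ.integrable_mul hL).congr (ae_of_all _ fun ζ => ?_)
    exact hmul φ ζ
  · have hψ' : schwartzFourierInv ψ = φ := by
      rw [← schwartzFourierInv_fourier φ]
      congr 1
      ext ζ
      rw [hψ, schwartzFourier_apply]
    have h1 : PointwiseConvergenceCLM.precomp ℂ ((weightCLM (-s) (-θ)).comp schwartzFourierInv)
        (Lp.toTemperedDistribution hL.toLp) ψ =
        Lp.toTemperedDistribution hL.toLp (weightCLM (-s) (-θ) (schwartzFourierInv ψ)) := rfl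
    rw [h1, hψ', Lp.toTemperedDistribution_apply]
    refine integral_congr_ae ?_
    filter_upwards [hL.coeFn_toLp] with ζ hζ
    rw [hζ, smul_eq_mul, hmul]

/-- A smooth compactly supported approximation of the weight times `f` in `L²` is divided by the
weight, which gives the Fourier transform of a Schwartz function. -/
theorem exists_schwartz_weightedL2Norm_sub_le {s θ : ℝ} {f : SpaceTime n → ℂ}
    (hf : AEStronglyMeasurable f volume) (h : weightedL2Norm s θ f < ∞) {ε : ℝ} (hε : 0 < ε) :
    ∃ u : 𝓢(SpaceTime n, ℂ),
      weightedL2Norm s θ (fun ζ => spacetimeFourier u ζ - f ζ) ≤ ENNReal.ofReal ε := by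
  have hL : MemLp (fun ζ => ((bourgainWeight s θ ζ : ℝ) : ℂ) * f ζ) 2 volume :=
    ⟨aestronglyMeasurable_weight_mul hf, h⟩
  obtain ⟨g, hg1, hg2, hg3⟩ := hL.exist_eLpNorm_sub_le ENNReal.ofNat_ne_top (by norm_num) hε
  refine ⟨schwartzFourierInv (weightCLM (-s) (-θ) (hg1.toSchwartzMap hg2)), ?_⟩
  rw [eLpNorm_sub_comm] at hg3
  refine le_of_eq_of_le ?_ hg3
  rw [weightedL2Norm_eq_eLpNorm]
  congr 1
  ext ζ
  rw [← schwartzFourier_apply, schwartzFourier_inv, weightCLM_apply, mul_sub,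
    bourgainWeight_mul_neg_mul]
  rfl

/-- Schwartz functions are dense in `X^{s,θ}`. -/
theorem exists_tendsto_distBourgainNorm {s θ : ℝ} {u : 𝓢'(SpaceTime n, ℂ)}
    (hu : distBourgainNorm s θ u < ∞) : ∃ u' : ℕ → 𝓢(SpaceTime n, ℂ),
      Tendsto (fun k => distBourgainNorm s θ (toDist (u' k) - u)) atTop (𝓝 0) := by
  obtain ⟨f, hf⟩ := exists_hasFourierTransform hu
  have hfin := hf.distBourgainNorm_eq s θ ▸ hu
  choose u' hu' using fun k : ℕ => exists_schwartz_weightedL2Norm_sub_le (s := s) (θ := θ)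
    hf.aestronglyMeasurable hfin (ε := 1 / ((k : ℝ) + 1)) (by positivity)
  refine ⟨u', ?_⟩
  have hlim : Tendsto (fun k : ℕ => ENNReal.ofReal (1 / ((k : ℝ) + 1))) atTop (𝓝 0) := by
    simpa using ENNReal.tendsto_ofReal (tendsto_one_div_add_atTop_nhds_zero_nat (𝕜 := ℝ))
  refine tendsto_of_tendsto_of_tendsto_of_le_of_le tendsto_const_nhds hlim
    (fun _ => zero_le) fun k => ?_
  rw [((hasFourierTransform_toDist (u' k)).sub hf).distBourgainNorm_eq]
  exact hu' k

end Completeness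

/-! ### The product by continuity -/

section Product

variable {n : ℕ} {s θ : ℝ} {C : ℝ≥0}

theorem BilinearBound.weightedL2Norm_conjConvolution_sub_le (hC : BilinearBound n s θ C)
    {f f' g g' : SpaceTime n → ℂ} (hf : AEStronglyMeasurable f volume)
    (hf' : AEStronglyMeasurable f' volume) (hg : AEStronglyMeasurable g volume)
    (hg' : AEStronglyMeasurable g' volume) (hfn : weightedL2Norm s θ f < ∞)
    (hfn' : weightedL2Norm s θ f' < ∞) (hgn : weightedL2Norm s θ g < ∞)
    (hgn' : weightedL2Norm s θ g' < ∞) :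
    weightedL2Norm s (θ - 1) (fun ζ => conjConvolution f g ζ - conjConvolution f' g' ζ) ≤
      C * (weightedL2Norm s θ (fun ζ => f ζ - f' ζ) * weightedL2Norm s θ g) +
      C * (weightedL2Norm s θ f' * weightedL2Norm s θ (fun ζ => g ζ - g' ζ)) := by
  have hae : (fun ζ => conjConvolution f g ζ - conjConvolution f' g' ζ) =ᵐ[volume]
      fun ζ => conjConvolution (fun η => f η - f' η) g ζ +
        conjConvolution f' (fun η => g η - g' η) ζ := by
    filter_upwards [hC.ae_integrable hf hg hfn hgn, hC.ae_integrable hf' hg hfn' hgn,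
      hC.ae_integrable hf' hg' hfn' hgn'] with ζ h1 h2 h3
    exact conjConvolution_sub_conjConvolution h1 h2 h3
  rw [weightedL2Norm_congr_ae hae]
  exact (weightedL2Norm_add_le (aestronglyMeasurable_conjConvolution (hf.sub hf') hg)
    (aestronglyMeasurable_conjConvolution hf' (hg.sub hg'))).trans
    (add_le_add (hC.weightedL2Norm_conjConvolution_le (hf.sub hf') hg)
      (hC.weightedL2Norm_conjConvolution_le hf' (hg.sub hg')))

theorem hasFourierTransform_conjMul (u v : 𝓢(SpaceTime n, ℂ)) :
    HasFourierTransform (toDist (conjMul u v))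
      (conjConvolution (spacetimeFourier u) (spacetimeFourier v)) := by
  have h : spacetimeFourier (conjMul u v) =
      conjConvolution (spacetimeFourier u) (spacetimeFourier v) :=
    funext (spacetimeFourier_conj_mul_conj u v)
  exact h ▸ hasFourierTransform_toDist (conjMul u v)

/-- The distribution with Fourier transform `conjConvolution û v̂` is the product `ū v̄`. -/
theorem BilinearBound.isConjProduct (hC : BilinearBound n s θ C) {u v w : 𝓢'(SpaceTime n, ℂ)}
    {f g : SpaceTime n → ℂ} (hf : HasFourierTransform u f) (hg : HasFourierTransform v g)
    (hw : HasFourierTransform w (conjConvolution f g)) (hfn : weightedL2Norm s θ f < ∞)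
    (hgn : weightedL2Norm s θ g < ∞) : IsConjProduct s θ u v w := by
  intro u' v' hu' hv'
  simp only [fun k => ((hasFourierTransform_toDist (u' k)).sub hf).distBourgainNorm_eq] at hu'
  simp only [fun k => ((hasFourierTransform_toDist (v' k)).sub hg).distBourgainNorm_eq] at hv'
  simp only [fun k => ((hasFourierTransform_conjMul (u' k) (v' k)).sub hw).distBourgainNorm_eq]
  set a := fun k => weightedL2Norm s θ fun ζ => spacetimeFourier (u' k) ζ - f ζ
  set b := fun k => weightedL2Norm s θ fun ζ => spacetimeFourier (v' k) ζ - g ζ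
  have hlim : Tendsto (fun k => (C : ℝ≥0∞) * (a k * (b k + weightedL2Norm s θ g)) +
      C * (weightedL2Norm s θ f * b k)) atTop (𝓝 0) := by
    have h1 : Tendsto (fun k => b k + weightedL2Norm s θ g) atTop
        (𝓝 (0 + weightedL2Norm s θ g)) := hv'.add tendsto_const_nhds
    have h2 := ENNReal.Tendsto.const_mul (a := (C : ℝ≥0∞))
      (ENNReal.Tendsto.mul hu' (Or.inr (by simpa using hgn.ne)) h1 (Or.inr (by simp)))
      (Or.inr ENNReal.coe_ne_top)
    have h3 := ENNReal.Tendsto.const_mul (a := (C : ℝ≥0∞))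
      (ENNReal.Tendsto.const_mul (a := weightedL2Norm s θ f) hv' (Or.inr hfn.ne))
      (Or.inr ENNReal.coe_ne_top)
    simpa using h2.add h3
  refine tendsto_of_tendsto_of_tendsto_of_le_of_le tendsto_const_nhds hlim
    (fun _ => zero_le) fun k => ?_
  have hv : weightedL2Norm s θ (spacetimeFourier (v' k)) ≤ b k + weightedL2Norm s θ g := by
    have := weightedL2Norm_add_le (s := s) (θ := θ)
      ((aestronglyMeasurable_spacetimeFourier (v' k)).sub hg.aestronglyMeasurable)
      hg.aestronglyMeasurable
    simp only [Pi.sub_apply, sub_add_cancel] at this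
    exact this
  refine (hC.weightedL2Norm_conjConvolution_sub_le (aestronglyMeasurable_spacetimeFourier _)
    hf.aestronglyMeasurable (aestronglyMeasurable_spacetimeFourier _) hg.aestronglyMeasurable
    (weightedL2Norm_spacetimeFourier_lt_top _ _ _) hfn
    (weightedL2Norm_spacetimeFourier_lt_top _ _ _) hgn).trans ?_
  gcongr

/-- Products are unique, since `u` and `v` are limits of Schwartz functions. -/
theorem IsConjProduct.eq {u v w w' : 𝓢'(SpaceTime n, ℂ)} (hu : distBourgainNorm s θ u < ∞)
    (hv : distBourgainNorm s θ v < ∞) (hw : IsConjProduct s θ u v w)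
    (hw' : IsConjProduct s θ u v w') : w' = w := by
  obtain ⟨u', hu'⟩ := exists_tendsto_distBourgainNorm hu
  obtain ⟨v', hv'⟩ := exists_tendsto_distBourgainNorm hv
  have hle : ∀ k, distBourgainNorm s (θ - 1) (w' - w) ≤
      distBourgainNorm s (θ - 1) (toDist (conjMul (u' k) (v' k)) - w) +
      distBourgainNorm s (θ - 1) (toDist (conjMul (u' k) (v' k)) - w') := by
    intro k
    have h1 : w' - w = (toDist (conjMul (u' k) (v' k)) - w) +
        -(toDist (conjMul (u' k) (v' k)) - w') := by abel
    rw [h1]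
    exact (distBourgainNorm_add_le _ _).trans (by gcongr; exact distBourgainNorm_neg_le _)
  have hlim := (hw u' v' hu' hv').add (hw' u' v' hu' hv')
  rw [add_zero] at hlim
  have h0 : distBourgainNorm s (θ - 1) (w' - w) = 0 :=
    le_antisymm (ge_of_tendsto' hlim hle) zero_le
  exact sub_eq_zero.1 (eq_zero_of_distBourgainNorm_eq_zero h0)

/-- Admissibility, in terms of `k = -s`: it forces `θ < 1`, and it gives the conditions under
which the dyadic sum converges. -/
theorem Admissible.exists_bilinearBound (h : Admissible n s θ) :
    ∃ C : ℝ≥0, BilinearBound n s θ C := by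
  rcases h with ⟨rfl, hθ, hne, hs, hs0⟩ | ⟨rfl, rfl, hs, hs0⟩ | ⟨rfl, hθ, hs, hs0⟩
  · rw [max_le_iff] at hs
    obtain ⟨h1, h2⟩ := hs
    -- the dyadic sum diverges only for `s = θ - 5 / 4` and `s = -1 / 2`, that is `θ = 3 / 4`;
    -- for `θ > 3 / 4` the bound `2θ - 2 ≤ s` is strictly stronger than `θ - 5 / 4 ≤ s`
    have hneg : 4 * -s + 4 * θ - 5 < 0 ∨ ((0 : ℕ) : ℝ) + 1 - 2 * -s < 0 := by
      rcases lt_or_gt_of_ne hne with h3 | h3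
      · by_cases h4 : 4 * -s + 4 * θ - 5 < 0
        · exact Or.inl h4
        · right
          push_cast
          linarith
      · left
        linarith
    obtain ⟨C, hC⟩ := exists_l2norm_bilinear_le 0 (θ := θ) (k := -s) hθ (by linarith)
      (by linarith) (by linarith) (by push_cast; linarith) hneg
    rw [neg_neg] at hC
    exact ⟨C, hC⟩
  · obtain ⟨C, hC⟩ := exists_l2norm_bilinear_le 0 (θ := 3 / 4) (k := -s) (by norm_num)
      (by norm_num) (by linarith) (by linarith) (by push_cast; linarith) (Or.inl (by linarith))
    rw [neg_neg] at hC
    exact ⟨C, hC⟩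
  · obtain ⟨C, hC⟩ := exists_l2norm_bilinear_le 1 (θ := θ) (k := -s) hθ (by linarith)
      (by linarith) (by linarith) (by push_cast; linarith) (Or.inl (by linarith))
    rw [neg_neg] at hC
    exact ⟨C, hC⟩

end Product

theorem mainTheorem3 (n : ℕ) (s θ : ℝ) (h : Admissible n s θ) :
    ∃ C : ℝ≥0,
      (∀ u v : 𝓢(SpaceTime n, ℂ),
        bourgainNorm s (θ - 1) (fun z => starRingEnd ℂ (u z) * starRingEnd ℂ (v z)) ≤
          C * bourgainNorm s θ u * bourgainNorm s θ v) ∧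
      (∀ u v : 𝓢'(SpaceTime n, ℂ),
        distBourgainNorm s θ u < ∞ → distBourgainNorm s θ v < ∞ →
          ∃ w : 𝓢'(SpaceTime n, ℂ),
            IsConjProduct s θ u v w ∧
            distBourgainNorm s (θ - 1) w ≤
              C * distBourgainNorm s θ u * distBourgainNorm s θ v ∧
            ∀ w' : 𝓢'(SpaceTime n, ℂ), IsConjProduct s θ u v w' → w' = w) := by
  obtain ⟨C, hC⟩ := h.exists_bilinearBound
  refine ⟨C, fun u v => ?_, fun u v hu hv => ?_⟩
  · have hconv := funext (spacetimeFourier_conj_mul_conj u v)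
    rw [bourgainNorm, hconv, mul_assoc]
    exact hC.weightedL2Norm_conjConvolution_le (aestronglyMeasurable_spacetimeFourier u)
      (aestronglyMeasurable_spacetimeFourier v)
  · obtain ⟨f, hf⟩ := exists_hasFourierTransform hu
    obtain ⟨g, hg⟩ := exists_hasFourierTransform hv
    have hfn := hf.distBourgainNorm_eq s θ ▸ hu
    have hgn := hg.distBourgainNorm_eq s θ ▸ hv
    have hle := hC.weightedL2Norm_conjConvolution_le hf.aestronglyMeasurable
      hg.aestronglyMeasurable
    obtain ⟨w, hw⟩ := exists_hasFourierTransform_of_weightedL2Norm_lt_top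
      (aestronglyMeasurable_conjConvolution hf.aestronglyMeasurable hg.aestronglyMeasurable)
      (hle.trans_lt (by finiteness))
    have hprod := hC.isConjProduct hf hg hw hfn hgn
    refine ⟨w, hprod, ?_, fun w' hw' => hprod.eq hu hv hw'⟩
    rw [hf.distBourgainNorm_eq, hg.distBourgainNorm_eq, hw.distBourgainNorm_eq, mul_assoc]
    exact hle
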